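/- Let $\Gamma$ be a countable discrete amenable group acting by homeomorphisms on a compact metrizable space $X$ with a fixed compatible metric. For a group $\Lambda$ acting on $X$ let $M^{\Lambda}(X)$ be the set of $\Lambda$-invariant regular Borel probability measures on $X$, and use the following terminology. Subequivalence. For $A,B\subseteq X$ write $A\precsim_\Lambda B$ if every closed $C\subseteq A$ has a finite open cover $U_1,\dots,U_n$ with elements $s_1,\dots,s_n\in\Lambda$ such that the sets $s_jU_j$ are pairwise disjoint and contained in $B$. For finite families of subsets, $\sum_i[A_i]\precsim_\Lambda\sum_k[B_k]$ means: for all closed $C_i\subseteq A_i$ there are finitely many open sets $U_j$, elements $s_j\in\Lambda$ and indices $a_j,b_j$ such that $C_i\subseteq\bigcup_{a_j=i}U_j$ for all $i$, $s_jU_j\subseteq B_{b_j}$ for all $j$, and $s_jU_j\cap s_{j'}U_{j'}=\emptyset$ whenever $j\ne j'$ and $b_j=b_{j'}$. Comparison. The action of $\Lambda$ has (dynamical) comparison if, for all open $U,V\subseteq X$, $\mu(U)<\mu(V)$ for all $\mu\in M^\Lambda(X)$ implies $U\precsim_\Lambda V$. It has comparison on multisets if, for all finite families of open sets, $\sum_i\mu(U_i)<\sum_j\mu(V_j)$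 for all $\mu\in M^\Lambda(X)$ implies $\sum_i[U_i]\precsim_\Lambda\sum_j[V_j]$. Almost finiteness. The action of $\Lambda$ is almost finite if for every nonempty finite $F\subset\Lambda$ and every $\varepsilon>0$ there are finite sets $S_1,\dots,S_n\subset\Lambda$ and open sets $V_1,\dots,V_n\subseteq X$ such that the levels $sV_i$ ($1\le i\le n$, $s\in S_i$) are pairwise disjoint and of diameter less than $\varepsilon$, $|S_i\triangle FS_i|<\varepsilon|S_i|$ for all $i$, and $X\setminus\bigsqcup_iS_iV_i\precsim_\Lambda\sum_i\lfloor\varepsilon|S_i|\rfloor[V_i]$. Good subgroups. The action of $\Gamma$ has good subgroups if for every finite $F\subset\Gamma$ and $N\in\mathbb N$ there are subgroups $\Lambda_1\le\Lambda_2\le\Gamma$ of cardinality at least $N$ such that $\Lambda_1\curvearrowright X$ is almost finite, $\Lambda_2\curvearrowright X$ has comparison on multisets, and $f\Lambda_1f^{-1}\subseteq\Lambda_2$ for all $f\in F$. Theorem. If the action $\Gamma\curvearrowright X$ has good subgroups, then it has comparison. If moreover the action is free, then it is almost finite. -/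

import Mathlib

open MeasureTheory
open scoped Pointwise symmDiff

namespace TopDyn

/-- Amenability of a discrete group (Folner condition): for every finite set `F` and every `ε > 0`
there is a nonempty finite set `S` with `|gS ∆ S| < ε |S|` for all `g ∈ F`. -/
def IsAmenable (Γ : Type*) [Group Γ] : Prop :=
  ∀ (F : Finset Γ) (ε : ℝ), 0 < ε →
    ∃ S : Finset Γ, S.Nonempty ∧
      ∀ g ∈ F, (((g • (S : Set Γ)) ∆ (S : Set Γ)).ncard : ℝ) < ε * S.card

/-- The action is free: only the identity has a fixed point. -/
def IsFree (Γ X : Type*) [Group Γ] [MulAction Γ X] : Prop :=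
  ∀ (g : Γ) (x : X), g • x = x → g = 1

/-- The finite set `S` is `(F, ε)`-invariant: `|S ∆ FS| < ε |S|`. (So `S` is nonempty.) -/
def IsInvariantShape {Γ : Type*} [Group Γ] (F : Finset Γ) (ε : ℝ) (S : Finset Γ) : Prop :=
  (((S : Set Γ) ∆ ((F : Set Γ) * (S : Set Γ))).ncard : ℝ) < ε * S.card

/-- The set of regular Borel probability measures on `X` that are invariant under `Γ`. -/
def invariantMeasures (Γ X : Type*) [Group Γ] [MulAction Γ X] [TopologicalSpace X]
    [MeasurableSpace X] : Set (Measure X) :=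
  {μ | IsProbabilityMeasure μ ∧ μ.Regular ∧ SMulInvariantMeasure Γ X μ}

/-- Dynamical subequivalence of sets: every closed `C ⊆ A` has a finite open cover whose members
can be translated by elements of `Γ` to pairwise disjoint subsets of `B`. -/
def Subequivalent (Γ : Type*) {X : Type*} [Group Γ] [MulAction Γ X] [TopologicalSpace X]
    (A B : Set X) : Prop :=
  ∀ C : Set X, IsClosed C → C ⊆ A →
    ∃ (n : ℕ) (U : Fin n → Set X) (s : Fin n → Γ),
      (∀ j, IsOpen (U j)) ∧
      C ⊆ ⋃ j, U j ∧
      (∀ j, s j • U j ⊆ B) ∧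
      Pairwise fun j k => Disjoint (s j • U j) (s k • U k)

/-- Dynamical subequivalence of multisets of subsets of `X`, i.e. of formal sums
`∑ i, [A i]` and `∑ k, [B k]`: for all closed sets `C i ⊆ A i` there are finitely many open sets
`U j`, where `U j` is used to cover `C (a j)` and is translated by `s j` into `B (b j)`, such that
the translates that land in the same summand `B k` are pairwise disjoint. -/
def MultisetSubequivalent (Γ : Type*) {X : Type*} [Group Γ] [MulAction Γ X] [TopologicalSpace X]
    {ι κ : Type*} (A : ι → Set X) (B : κ → Set X) : Prop :=
  ∀ C : ι → Set X, (∀ i, IsClosed (C i)) → (∀ i, C i ⊆ A i) →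
    ∃ (n : ℕ) (U : Fin n → Set X) (s : Fin n → Γ) (a : Fin n → ι) (b : Fin n → κ),
      (∀ j, IsOpen (U j)) ∧
      (∀ i, C i ⊆ ⋃ (j : Fin n) (_ : a j = i), U j) ∧
      (∀ j, s j • U j ⊆ B (b j)) ∧
      ∀ j k, j ≠ k → b j = b k → Disjoint (s j • U j) (s k • U k)

/-- A castle: finitely many towers with finite shapes `S i` and open bases `V i`, such that all
levels `s V i`, `s ∈ S i`, are pairwise disjoint. -/
def IsCastle {Γ X : Type*} [Group Γ] [MulAction Γ X] [TopologicalSpace X] {n : ℕ}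
    (S : Fin n → Finset Γ) (V : Fin n → Set X) : Prop :=
  (∀ i, IsOpen (V i)) ∧
  ∀ i j, ∀ s ∈ S i, ∀ t ∈ S j, (i ≠ j ∨ s ≠ t) → Disjoint (s • V i) (t • V j)

/-- Almost finiteness. The finite set `F` is taken nonempty, because no nonempty finite set is
`(∅, ε)`-invariant for `ε ≤ 1`. The right-hand side of the last clause is the multiset in which
`V i` occurs `⌊ε |S i|⌋` times. -/
def IsAlmostFinite (Γ X : Type*) [Group Γ] [MetricSpace X] [MulAction Γ X] : Prop :=
  ∀ (F : Finset Γ), F.Nonempty → ∀ ε : ℝ, 0 < ε →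
    ∃ (n : ℕ) (S : Fin n → Finset Γ) (V : Fin n → Set X),
      IsCastle S V ∧
      (∀ i, IsInvariantShape F ε (S i)) ∧
      (∀ i, ∀ s ∈ S i, Metric.diam (s • V i) < ε) ∧
      MultisetSubequivalent Γ
        (fun _ : Unit => (Set.univ : Set X) \ ⋃ (i : Fin n) (s ∈ S i), s • V i)
        (fun p : (i : Fin n) × Fin ⌊ε * ((S i).card : ℝ)⌋₊ => V p.1)

/-- (Dynamical) comparison. -/
def HasComparison (Γ X : Type*) [Group Γ] [MulAction Γ X] [TopologicalSpace X]
    [MeasurableSpace X] : Prop :=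
  ∀ U V : Set X, IsOpen U → IsOpen V →
    (∀ μ ∈ invariantMeasures Γ X, μ U < μ V) → Subequivalent Γ U V

/-- Comparison on multisets. -/
def HasMultisetComparison (Γ X : Type*) [Group Γ] [MulAction Γ X] [TopologicalSpace X]
    [MeasurableSpace X] : Prop :=
  ∀ (n m : ℕ) (U : Fin n → Set X) (V : Fin m → Set X),
    (∀ i, IsOpen (U i)) → (∀ j, IsOpen (V j)) →
    (∀ μ ∈ invariantMeasures Γ X, ∑ i, μ (U i) < ∑ j, μ (V j)) →
    MultisetSubequivalent Γ U V

/-- The action has good subgroups. -/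
def HasGoodSubgroups (Γ X : Type*) [Group Γ] [MetricSpace X] [MeasurableSpace X]
    [MulAction Γ X] : Prop :=
  ∀ (F : Finset Γ) (N : ℕ), ∃ Λ₁ Λ₂ : Subgroup Γ,
    Λ₁ ≤ Λ₂ ∧
    (N : ℕ∞) ≤ ENat.card Λ₁ ∧ (N : ℕ∞) ≤ ENat.card Λ₂ ∧
    IsAlmostFinite Λ₁ X ∧
    HasMultisetComparison Λ₂ X ∧
    ∀ f ∈ F, ∀ g ∈ Λ₁, f * g * f⁻¹ ∈ Λ₂

end TopDyn

set_option linter.unusedSectionVars false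

/-! Comparison. Let `C` be closed and `V` open with μ(C) < μ(V) for every Γ-invariant μ, and put E =
X \ V. By amenability and weak-* compactness, one finite set S ⊂ Γ has the property that the
averages over S of smoothed indicators of C and E add up to at most 1 - η along every orbit
(`exists_averaging_set`). Take good subgroups Λ₁ ≤ Λ₂ for S⁻¹. A fine castle of Λ₁ with tall towers
allows the levels meeting C, and those inside V, to be dealt out evenly to |S| colours
(`exists_division`). This gives sets U_b covering C up to a small open R, and disjoint W_b ⊆ V, for
b ∈ S, with estimates valid for all Λ₁-invariant measures at once. If ν is Λ₂-invariant, its image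
under b ∈ S is Λ₁-invariant, because b⁻¹Λ₁b ⊆ Λ₂. Hence ν(b⁻¹U_b) and ν(b⁻¹W_b) are controlled by
integrals of the bumps at bx, and summing over b recreates the S-averages: ν(R) + Σ ν(b⁻¹U_b) < Σ
ν(b⁻¹W_b). Multiset comparison for Λ₂, conjugated back by the elements b, moves C into V
(`exists_disjoint_translates`).

Almost finiteness. Almost finiteness of a subgroup yields bases of open sets whose boundaries are
null for all invariant measures (`exists_open_null_frontier`). With such sets and freeness, the
greedy tiling argument of Ornstein and Weiss runs uniformly over all invariant measures: each round
tiles with a new Følner shape wherever its translates are covered to a proportion at most θ, and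
shrinks the uncovered measure by nearly a factor 1 - θ (`exists_tiled`). Passing to interiors of the
bases costs no measure. The remainder is then closed and of small measure, and the comparison result
moves it into a few levels of each tower. -/

namespace TopDyn

open Filter Topology BoundedContinuousFunction
open scoped NNReal

/-! ### Orbit averages and invariant limit measures. -/

section Averaging

variable {X : Type*} [MetricSpace X]

/-- A continuous function with values in `[0, 1]` which is `1` near `E` and `0` away from `E`. -/
noncomputable def bump (E : Set X) (n : ℕ) : X →ᵇ ℝ≥0 :=
  thickenedIndicator (show (0 : ℝ) < (1 / 2) ^ n by positivity) (Metric.cthickening ((1 / 2) ^ n) E)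

lemma bump_le_one (E : Set X) (n : ℕ) (x : X) : bump E n x ≤ 1 :=
  thickenedIndicator_le_one _ _ _

lemma bump_eq_one {E : Set X} {n : ℕ} {x : X} (hx : x ∈ Metric.cthickening ((1 / 2) ^ n) E) :
    bump E n x = 1 :=
  thickenedIndicator_one _ _ hx

lemma mem_cthickening_of_bump_ne_zero {E : Set X} {n : ℕ} {x : X} (hx : bump E n x ≠ 0) :
    x ∈ Metric.cthickening ((1 / 2) ^ n + (1 / 2) ^ n) E := by
  by_contra h
  refine hx (thickenedIndicator_zero _ _ fun h' => h ?_)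
  exact Metric.cthickening_cthickening_subset (by positivity) (by positivity) _
    (Metric.thickening_subset_cthickening _ _ h')

/-- The radii are halved at each stage, so the support of a later bump lies where every earlier one
equals 1. -/
lemma bump_antitone (E : Set X) {m n : ℕ} (h : m < n) (x : X) : bump E n x ≤ bump E m x := by
  by_cases hx : bump E n x = 0
  · simp [hx]
  · rw [bump_eq_one (n := m)]
    · exact bump_le_one _ _ _
    · refine Metric.cthickening_mono ?_ _ (mem_cthickening_of_bump_ne_zero hx)
      have h1 : ((1 : ℝ) / 2) ^ n ≤ (1 / 2) ^ (m + 1) :=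
        pow_le_pow_of_le_one (by norm_num) (by norm_num) h
      rw [pow_succ] at h1
      linarith

variable [MeasurableSpace X] [BorelSpace X]

lemma integrable_bump (μ : Measure X) [IsFiniteMeasure μ] (E : Set X) (n : ℕ) :
    Integrable (fun x => (bump E n x : ℝ)) μ :=
  (integrable_const (1 : ℝ)).mono'
    (NNReal.continuous_coe.comp (bump E n).continuous).measurable.aestronglyMeasurable
    (ae_of_all _ fun x => by
      simpa using bump_le_one E n x)

lemma integral_bump_le (μ : Measure X) [IsFiniteMeasure μ] (E : Set X) (n : ℕ) :
    ∫ x, (bump E n x : ℝ) ∂μ ≤ μ.real (Metric.cthickening ((1 / 2) ^ n + (1 / 2) ^ n) E) := by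
  rw [← integral_indicator_one Metric.isClosed_cthickening.measurableSet]
  refine integral_mono (integrable_bump μ E n)
    ((integrable_const (1 : ℝ)).indicator Metric.isClosed_cthickening.measurableSet) fun x => ?_
  by_cases hx : bump E n x = 0
  · simp only [hx]
    exact Set.indicator_nonneg (fun _ _ => zero_le_one) _
  · rw [Set.indicator_of_mem (mem_cthickening_of_bump_ne_zero hx)]
    exact_mod_cast bump_le_one E n x

lemma exists_integral_bump_lt (μ : Measure X) [IsFiniteMeasure μ] {E : Set X} (hE : IsClosed E)
    {r : ℝ} (hr : μ.real E < r) : ∃ N, ∀ n ≥ N, ∫ x, (bump E n x : ℝ) ∂μ < r := by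
  have h0 : Tendsto (fun n : ℕ => ((1 : ℝ) / 2) ^ n + (1 / 2) ^ n) atTop (𝓝 0) := by
    have := tendsto_pow_atTop_nhds_zero_of_lt_one (r := (1 : ℝ) / 2) (by norm_num) (by norm_num)
    simpa using this.add this
  have h1 := (tendsto_measure_cthickening_of_isClosed (μ := μ) ⟨1, one_pos, measure_ne_top _ _⟩
    hE).comp h0
  have h2 := (ENNReal.tendsto_toReal (measure_ne_top μ E)).comp h1
  have h3 := h2.eventually_lt_const hr
  obtain ⟨N, hN⟩ := eventually_atTop.1 h3
  exact ⟨N, fun n hn => (integral_bump_le μ E n).trans_lt (hN n hn)⟩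

/-- The empirical measure of the points `g • x`, `g ∈ S`. -/
noncomputable def empirical {Γ : Type*} [SMul Γ X] (S : Finset Γ) (x : X) : Measure X :=
  (S.card : ENNReal)⁻¹ • ∑ g ∈ S, Measure.dirac (g • x)

lemma isProbabilityMeasure_empirical {Γ : Type*} [SMul Γ X] {S : Finset Γ} (hS : S.Nonempty)
    (x : X) : IsProbabilityMeasure (empirical S x) := by
  constructor
  simp only [empirical, Measure.smul_apply, Measure.finsetSum_apply, measure_univ,
    Finset.sum_const, nsmul_eq_mul, mul_one, smul_eq_mul]
  exact ENNReal.inv_mul_cancel (by simpa using hS.ne_empty) (by simp)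

lemma integral_empirical {Γ : Type*} [SMul Γ X] (S : Finset Γ) (x : X) (f : X →ᵇ ℝ) :
    ∫ y, f y ∂(empirical S x) = (S.card : ℝ)⁻¹ * ∑ g ∈ S, f (g • x) := by
  rw [empirical, integral_smul_measure, integral_finsetSum_measure]
  · simp
  · intro g _
    exact f.integrable _

lemma abs_sum_sub_sum_le {Γ : Type*} [Group Γ] (S : Finset Γ) (h : Γ)
    (φ : Γ → ℝ) {B : ℝ} (hB : ∀ g, |φ g| ≤ B) :
    |∑ g ∈ S, φ (h * g) - ∑ g ∈ S, φ g| ≤ (((h • (S : Set Γ)) ∆ (S : Set Γ)).ncard : ℝ) * B := by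
  classical
  have h1 : ∑ g ∈ S, φ (h * g) = ∑ g ∈ h • S, φ g := by
    rw [← Finset.image_smul, Finset.sum_image (by intro a _ b _ hab; simpa using hab)]
    rfl
  have h2 : ((h • (S : Set Γ)) ∆ (S : Set Γ)) = ((((h • S) \ S) ∪ (S \ (h • S)) : Finset Γ) : Set Γ) := by
    simp [symmDiff_def]
  rw [h1, h2, Set.ncard_coe_finset, ← Finset.sum_sdiff_sub_sum_sdiff,
    Finset.card_union_of_disjoint (disjoint_sdiff_sdiff)]
  have h3 : ∀ T : Finset Γ, |∑ g ∈ T, φ g| ≤ T.card * B := fun T =>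
    (Finset.abs_sum_le_sum_abs _ _).trans ((Finset.sum_le_card_nsmul _ _ B fun g _ => hB g).trans
      (by simp))
  have h4 := h3 (h • S \ S)
  have h5 := h3 (S \ h • S)
  push_cast
  rw [abs_le] at *
  constructor <;> nlinarith

variable [CompactSpace X] {Γ : Type*} [Group Γ] [MulAction Γ X] [ContinuousConstSMul Γ X]

lemma mem_invariantMeasures_of_integral_eq (μ : Measure X) [IsProbabilityMeasure μ]
    (h : ∀ (g : Γ) (f : X →ᵇ ℝ), ∫ x, f (g • x) ∂μ = ∫ x, f x ∂μ) :
    μ ∈ invariantMeasures Γ X := by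
  refine ⟨inferInstance, inferInstance, ⟨fun g s hs => ?_⟩⟩
  have hg : Measurable (fun x : X => g • x) := (continuous_const_smul g).measurable
  have : μ.map (fun x => g • x) = μ := by
    have : IsFiniteMeasure (μ.map (fun x : X => g • x)) := by infer_instance
    refine ext_of_forall_integral_eq_of_IsFiniteMeasure fun f => ?_
    rw [integral_map hg.aemeasurable f.continuous.aestronglyMeasurable]
    exact h g f
  conv_rhs => rw [← this, Measure.map_apply hg hs]

/-- If every invariant probability measure gives the closed sets `C` and `E` total mass less than
one, then the averages along a suitable finite set of the orbit of any point witness this. -/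
theorem exists_averaging_set (hΓ : IsAmenable Γ) {C E : Set X} (hC : IsClosed C) (hE : IsClosed E)
    (h : ∀ μ ∈ invariantMeasures Γ X, μ.real C + μ.real E < 1) :
    ∃ (S : Finset Γ) (n : ℕ) (η : ℝ), S.Nonempty ∧ 0 < η ∧
      ∀ x : X, ∑ g ∈ S, ((bump C n (g • x) : ℝ) + bump E n (g • x)) ≤ (1 - η) * S.card := by
  classical
  -- Otherwise every Følner set has a bad point; a limit of the empirical measures at bad points is
  -- invariant and contradicts `h`. The index records the finite set to be respected and the
  -- precision.
  by_contra! hcon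
  choose S hSne hS using fun i : Finset Γ × ℕ => hΓ i.1 (1 / ((i.2 : ℝ) + 1)) (by positivity)
  choose x hx using fun i : Finset Γ × ℕ =>
    hcon (S i) i.2 (1 / ((i.2 : ℝ) + 1)) (hSne i) (by positivity)
  let p : Finset Γ × ℕ → ProbabilityMeasure X := fun i =>
    ⟨empirical (S i) (x i), isProbabilityMeasure_empirical (hSne i) (x i)⟩
  let 𝒰 : Ultrafilter (Finset Γ × ℕ) := Ultrafilter.of atTop
  obtain ⟨q, -, hq⟩ := (isCompact_univ (X := ProbabilityMeasure X)).ultrafilter_le_nhds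
    (𝒰.map p) (by simp)
  have hlim : ∀ f : X →ᵇ ℝ, Tendsto (fun i => (((S i).card : ℝ)⁻¹ * ∑ g ∈ S i, f (g • x i))) 𝒰
      (𝓝 (∫ y, f y ∂(q : Measure X))) := by
    intro f
    have := (ProbabilityMeasure.tendsto_iff_forall_integral_tendsto (F := (𝒰 : Filter _))
      (μs := p) (μ := q)).1 (show Tendsto p 𝒰 (𝓝 q) from hq) f
    refine this.congr fun i => ?_
    exact integral_empirical _ _ _
  have hpos : ∀ i, (0 : ℝ) < (S i).card := fun i => by exact_mod_cast (hSne i).card_pos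
  have hsmall : Tendsto (fun i : Finset Γ × ℕ => 1 / ((i.2 : ℝ) + 1)) 𝒰 (𝓝 0) := by
    have h1 : Tendsto (fun i : Finset Γ × ℕ => i.2) atTop atTop := by
      rw [← prod_atTop_atTop_eq]; exact tendsto_snd
    exact (tendsto_one_div_add_atTop_nhds_zero_nat.comp h1).mono_left (Ultrafilter.of_le _)
  have hinv : (q : Measure X) ∈ invariantMeasures Γ X := by
    refine mem_invariantMeasures_of_integral_eq _ fun g f => ?_
    let fg : X →ᵇ ℝ := f.compContinuous ⟨fun x => g • x, continuous_const_smul g⟩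
    have h1 := (hlim fg).sub (hlim f)
    have h2 : Tendsto (fun i : Finset Γ × ℕ => 1 / ((i.2 : ℝ) + 1) * ‖f‖) 𝒰 (𝓝 0) := by
      simpa using hsmall.mul_const ‖f‖
    have hev : ∀ᶠ i in (𝒰 : Filter (Finset Γ × ℕ)), g ∈ i.1 := by
      refine (Ultrafilter.of_le (atTop : Filter (Finset Γ × ℕ))) ?_
      filter_upwards [eventually_ge_atTop (({g} : Finset Γ), 0)] with i hi
      exact hi.1 (by simp)
    have h3 := squeeze_zero_norm' (t₀ := (𝒰 : Filter _)) (f := fun i => (((S i).card : ℝ)⁻¹ * ∑ g ∈ S i, fg (g • x i)) -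
      (((S i).card : ℝ)⁻¹ * ∑ g ∈ S i, f (g • x i))) (by
      filter_upwards [hev] with i hi
      have h4 := abs_sum_sub_sum_le (S i) g (fun t => f (t • x i)) (B := ‖f‖)
        (fun t => f.norm_coe_le_norm _)
      have h5 := hS i g hi
      have h6 : ∀ t, fg (t • x i) = f ((g * t) • x i) := fun t => by
        simp [fg, mul_smul]
      simp only [h6]
      rw [← mul_sub, norm_mul, norm_inv, Real.norm_eq_abs, Real.norm_eq_abs,
        abs_of_pos (hpos i), inv_mul_le_iff₀ (hpos i)]
      refine h4.trans ?_
      calc _ ≤ (1 / ((i.2 : ℝ) + 1) * (S i).card) * ‖f‖ := by gcongr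
        _ = _ := by ring) h2
    have := tendsto_nhds_unique h1 h3
    simp only [fg, BoundedContinuousFunction.compContinuous_apply, ContinuousMap.coe_mk] at this
    linarith
  have hlt := h _ hinv
  obtain ⟨r, hr1, hr2⟩ : ∃ r : ℝ, 0 < r ∧
      (q : Measure X).real C + r + ((q : Measure X).real E + r) < 1 :=
    ⟨(1 - ((q : Measure X).real C + (q : Measure X).real E)) / 4, by linarith, by linarith⟩
  obtain ⟨m₁, hm₁⟩ := exists_integral_bump_lt (q : Measure X) hC (lt_add_of_pos_right _ hr1)
  obtain ⟨m₂, hm₂⟩ := exists_integral_bump_lt (q : Measure X) hE (lt_add_of_pos_right _ hr1)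
  set m := max m₁ m₂
  have hm₁' := hm₁ m (le_max_left _ _)
  have hm₂' := hm₂ m (le_max_right _ _)
  let f : X →ᵇ ℝ := BoundedContinuousFunction.mkOfCompact
    ⟨fun y => (bump C m y : ℝ) + bump E m y,
      (NNReal.continuous_coe.comp (bump C m).continuous).add
        (NNReal.continuous_coe.comp (bump E m).continuous)⟩
  have hf : ∫ y, f y ∂(q : Measure X) < 1 := by
    have : ∫ y, f y ∂(q : Measure X) = ∫ y, (bump C m y : ℝ) ∂(q : Measure X) +
        ∫ y, (bump E m y : ℝ) ∂(q : Measure X) :=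
      integral_add (integrable_bump _ _ _) (integrable_bump _ _ _)
    rw [this]
    linarith
  have hev : ∀ᶠ i in (𝒰 : Filter (Finset Γ × ℕ)), 1 - 1 / ((i.2 : ℝ) + 1) ≤
      ((S i).card : ℝ)⁻¹ * ∑ g ∈ S i, f (g • x i) := by
    refine (Ultrafilter.of_le (atTop : Filter (Finset Γ × ℕ))) ?_
    -- The bumps at stage `i.2 > m` lie below those at stage `m`, so the failure at `i` passes to
    -- the fixed continuous function `f`.
    filter_upwards [eventually_ge_atTop ((∅ : Finset Γ), m + 1)] with i hi
    have him : m < i.2 := hi.2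
    rw [le_inv_mul_iff₀ (hpos i), mul_comm]
    refine (hx i).le.trans (Finset.sum_le_sum fun g _ => ?_)
    exact add_le_add (by exact_mod_cast bump_antitone C him _)
      (by exact_mod_cast bump_antitone E him _)
  have := le_of_tendsto_of_tendsto (tendsto_const_nhds.sub hsmall) (hlim f) hev
  linarith

end Averaging

/-! ### Castles and even division of their levels. -/

section Division

/-- Enumerate `T` and colour by the index modulo the number of colours. -/
lemma exists_balanced_coloring {α β : Type*} [DecidableEq β] (T : Finset α) {K : Finset β} (hK : K.Nonempty) :
    ∃ c : α → β, (∀ a, c a ∈ K) ∧ ∀ b ∈ K,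
      |(({a ∈ T | c a = b}.card : ℕ) : ℝ) - (T.card : ℝ) / K.card| ≤ 1 := by
  classical
  have hq : 0 < K.card := hK.card_pos
  let e := T.equivFin
  let f := K.equivFin
  let idx : α → ℕ := fun a => if h : a ∈ T then (e ⟨a, h⟩ : ℕ) else 0
  refine ⟨fun a => f.symm ⟨idx a % K.card, Nat.mod_lt _ hq⟩, fun a => (f.symm _).2, fun b hb => ?_⟩
  have h1 : ({a ∈ T | ((f.symm ⟨idx a % K.card, Nat.mod_lt _ hq⟩ : K) : β) = b}.card : ℕ) =
      Nat.count (· ≡ (f ⟨b, hb⟩ : ℕ) [MOD K.card]) T.card := by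
    rw [Nat.count_eq_card_filter_range]
    refine Finset.card_bij (fun a _ => idx a) ?_ ?_ ?_
    · intro a ha
      obtain ⟨haT, hab⟩ := Finset.mem_filter.1 ha
      have h2 : (⟨idx a % K.card, Nat.mod_lt _ hq⟩ : Fin K.card) = f ⟨b, hb⟩ := by
        rw [← Equiv.symm_apply_eq]
        exact Subtype.ext hab
      refine Finset.mem_filter.2 ⟨?_, ?_⟩
      · simp [idx, haT]
      · rw [← h2]
        exact (Nat.mod_modEq _ _).symm
    · intro a ha a' ha' h
      have haT := (Finset.mem_filter.1 ha).1
      have haT' := (Finset.mem_filter.1 ha').1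
      simp only [idx, haT, haT', dif_pos] at h
      have := e.injective (Fin.ext h)
      simpa using this
    · intro k hk
      obtain ⟨hk1, hk2⟩ := Finset.mem_filter.1 hk
      have hk1 := Finset.mem_range.1 hk1
      have hidx : idx (e.symm ⟨k, hk1⟩ : T) = k := by simp [idx]
      refine ⟨(e.symm ⟨k, hk1⟩ : T), Finset.mem_filter.2 ⟨(e.symm _).2, ?_⟩, hidx⟩
      have : (⟨idx (e.symm ⟨k, hk1⟩ : T) % K.card, Nat.mod_lt _ hq⟩ : Fin K.card) =
          f ⟨b, hb⟩ := by
        ext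
        simp only [hidx]
        rw [hk2, Nat.mod_eq_of_lt (f ⟨b, hb⟩).2]
      rw [this]
      simp
  rw [h1, Nat.count_modEq_card _ hq]
  have h3 : (T.card : ℝ) = K.card * (T.card / K.card : ℕ) + (T.card % K.card : ℕ) := by
    exact_mod_cast (Nat.div_add_mod _ _).symm
  have h4 : ((T.card % K.card : ℕ) : ℝ) < K.card := by exact_mod_cast Nat.mod_lt _ hq
  have h5 : (0 : ℝ) < K.card := by exact_mod_cast hq
  have h6 : (T.card : ℝ) / K.card = (T.card / K.card : ℕ) + ((T.card % K.card : ℕ) : ℝ) / K.card := by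
    rw [h3]
    field_simp
  have h7 : ((T.card % K.card : ℕ) : ℝ) / K.card < 1 := by rwa [div_lt_one h5]
  have h8 : 0 ≤ ((T.card % K.card : ℕ) : ℝ) / K.card := by positivity
  rw [h6]
  push_cast
  rw [abs_le]
  split_ifs <;> constructor <;> linarith

variable {G X : Type*} [Group G]

/-- Invariance under a large set forces a large shape, since a nonempty `S` satisfies |F| ≤ |FS| ≤
|S| + |S ∆ FS|. This is how large subgroups produce tall towers. -/
lemma IsInvariantShape.card_le {F S : Finset G} {ε : ℝ} (h : IsInvariantShape F ε S) :
    (F.card : ℝ) ≤ (1 + ε) * S.card := by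
  classical
  have hS : S.Nonempty := by
    by_contra h0
    rw [Finset.not_nonempty_iff_eq_empty] at h0
    simp [IsInvariantShape, h0] at h
  have h1 : F.card ≤ (F * S).card := Finset.card_le_card_mul_right hS
  have h2 : ((F * S : Finset G) : Set G) ⊆ (S : Set G) ∪ ((S : Set G) ∆ ((F : Set G) * (S : Set G))) := by
    intro x hx
    rw [Finset.coe_mul] at hx
    by_cases hxS : x ∈ (S : Set G)
    · exact Or.inl hxS
    · exact Or.inr (Or.inr ⟨hx, hxS⟩)
  have h3 : (F * S).card ≤ S.card + ((S : Set G) ∆ ((F : Set G) * (S : Set G))).ncard := by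
    rw [← Set.ncard_coe_finset, ← Set.ncard_coe_finset S]
    refine (Set.ncard_le_ncard h2 ?_).trans (Set.ncard_union_le _ _)
    rw [← Finset.coe_mul, ← Finset.coe_symmDiff, ← Finset.coe_union]
    exact Finset.finite_toSet _
  have h4 : (F.card : ℝ) ≤ S.card + ((S : Set G) ∆ ((F : Set G) * (S : Set G))).ncard := by
    exact_mod_cast h1.trans h3
  unfold IsInvariantShape at h
  linarith

variable [MulAction G X] [MetricSpace X]

lemma IsCastle.measureReal_iUnion [MeasurableSpace X] [BorelSpace X] [ContinuousConstSMul G X]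
    {n : ℕ} {S : Fin n → Finset G} {V : Fin n → Set X} (h : IsCastle S V) {μ : Measure X}
    (hμ : μ ∈ invariantMeasures G X) {T : Fin n → Finset G} (hT : ∀ i, T i ⊆ S i) :
    μ.real (⋃ i, ⋃ s ∈ T i, s • V i) = ∑ i, ((T i).card : ℝ) * μ.real (V i) := by
  obtain ⟨_, _, _⟩ := hμ
  have h1 : (⋃ i, ⋃ s ∈ T i, s • V i) =
      ⋃ p ∈ Finset.univ.sigma T, p.2 • V p.1 := by
    ext x
    simp only [Set.mem_iUnion, Finset.mem_sigma, Finset.mem_univ, true_and, exists_prop]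
    constructor
    · rintro ⟨i, s, hs, hx⟩
      exact ⟨⟨i, s⟩, hs, hx⟩
    · rintro ⟨⟨i, s⟩, hs, hx⟩
      exact ⟨i, s, hs, hx⟩
  rw [h1, measureReal_biUnion_finset]
  · rw [Finset.sum_sigma]
    refine Finset.sum_congr rfl fun i _ => ?_
    simp [measureReal_def]
  · rintro ⟨i, s⟩ hs ⟨j, t⟩ ht hne
    refine h.2 i j s (hT i (by simpa using hs)) t (hT j (by simpa using ht)) ?_
    by_contra! hc
    obtain ⟨rfl, rfl⟩ := hc
    exact hne rfl
  · rintro ⟨i, s⟩ -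
    exact ((h.1 i).smul s).measurableSet

lemma IsCastle.sum_card_mul_measureReal_le [MeasurableSpace X] [BorelSpace X]
    [ContinuousConstSMul G X] {n : ℕ} {S : Fin n → Finset G} {V : Fin n → Set X}
    (h : IsCastle S V) {μ : Measure X} (hμ : μ ∈ invariantMeasures G X) :
    ∑ i, ((S i).card : ℝ) * μ.real (V i) ≤ 1 := by
  have := hμ.1
  rw [← h.measureReal_iUnion hμ fun i => Finset.Subset.refl _]
  exact measureReal_le_one

/-- An almost finite action admits castles whose remainder has an open neighbourhood of small
measure. -/
lemma IsAlmostFinite.exists_castle [MeasurableSpace X] [BorelSpace X] [ContinuousConstSMul G X]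
    (h : IsAlmostFinite G X) {F : Finset G} (hF : F.Nonempty) {ε : ℝ} (hε : 0 < ε) :
    ∃ (n : ℕ) (S : Fin n → Finset G) (V : Fin n → Set X) (R : Set X),
      IsCastle S V ∧ (∀ i, IsInvariantShape F ε (S i)) ∧
      (∀ i, ∀ s ∈ S i, Metric.diam (s • V i) < ε) ∧
      IsOpen R ∧ (∀ x, x ∈ R ∨ ∃ i, ∃ s ∈ S i, x ∈ s • V i) ∧
      ∀ μ ∈ invariantMeasures G X, μ.real R ≤ ε := by
  obtain ⟨n, S, V, hc, hS, hd, hm⟩ := h F hF ε hε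
  have hclosed : IsClosed ((Set.univ : Set X) \ ⋃ (i : Fin n) (s ∈ S i), s • V i) := by
    rw [← Set.compl_eq_univ_sdiff]
    exact (isOpen_iUnion fun i => isOpen_iUnion fun s => isOpen_iUnion fun _ =>
      (hc.1 i).smul s).isClosed_compl
  obtain ⟨m, U, t, a, b, hU, hcov, hsub, hdisj⟩ := hm _ (fun _ => hclosed) fun _ => subset_rfl
  refine ⟨n, S, V, ⋃ j, U j, hc, hS, hd, isOpen_iUnion hU, fun x => ?_, fun μ hμ => ?_⟩
  · by_cases hx : ∃ i, ∃ s ∈ S i, x ∈ s • V i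
    · exact Or.inr hx
    · left
      have : x ∈ ⋃ (j : Fin m) (_ : a j = ()), U j := hcov () ⟨trivial, by simpa using hx⟩
      simp only [Set.mem_iUnion] at this ⊢
      obtain ⟨j, _, hj⟩ := this
      exact ⟨j, hj⟩
  · classical
    have hle := hc.sum_card_mul_measureReal_le hμ
    obtain ⟨_, _, _⟩ := hμ
    -- Group the translates by the copy of a base in which they land; within one copy they are
    -- disjoint.
    calc μ.real (⋃ j, U j) ≤ ∑ j, μ.real (U j) := measureReal_iUnion_fintype_le _
      _ = ∑ j, μ.real (t j • U j) := by simp [measureReal_def]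
      _ = ∑ p, ∑ j with b j = p, μ.real (t j • U j) := (Finset.sum_fiberwise _ _ _).symm
      _ ≤ ∑ p : (i : Fin n) × Fin ⌊ε * ((S i).card : ℝ)⌋₊, μ.real (V p.1) := by
          refine Finset.sum_le_sum fun p _ => ?_
          rw [← measureReal_biUnion_finset]
          · refine measureReal_mono (Set.iUnion₂_subset fun j hj => ?_)
            have hj := (Finset.mem_filter.1 hj).2
            rw [← hj]
            exact hsub j
          · intro j hj k hk hne
            simp only [Finset.coe_filter, Finset.mem_univ, true_and, Set.mem_ofPred_eq] at hj hk
            exact hdisj j k hne (hj.trans hk.symm)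
          · exact fun j _ => ((hU j).smul _).measurableSet
      _ = ∑ i, (⌊ε * ((S i).card : ℝ)⌋₊ : ℝ) * μ.real (V i) := by
          rw [Fintype.sum_sigma]
          simp
      _ ≤ ∑ i, (ε * (S i).card) * μ.real (V i) := by
          gcongr with i
          exact Nat.floor_le (by positivity)
      _ = ε * ∑ i, ((S i).card : ℝ) * μ.real (V i) := by
          rw [Finset.mul_sum]
          simp [mul_assoc]
      _ ≤ ε := by nlinarith

variable [CompactSpace X]

lemma dist_le_diam_of_compactSpace {A : Set X} {x y : X} (hx : x ∈ A) (hy : y ∈ A) :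
    dist x y ≤ Metric.diam A :=
  Metric.dist_le_diam_of_mem (Metric.isBounded_of_compactSpace) hx hy

/-- Using an almost finite action of a large group, a closed set `C` and the complement of a
closed set `E` can be divided into parts of almost equal size. -/
theorem IsAlmostFinite.exists_division [MeasurableSpace X] [BorelSpace X] [ContinuousConstSMul G X]
    (h : IsAlmostFinite G X) (C E : Set X) (n : ℕ) {β : Type*} {K : Finset β} (hK : K.Nonempty)
    {ε : ℝ} (hε : 0 < ε) {F : Finset G} (hF : 4 / ε ≤ F.card) :
    ∃ (R : Set X) (U W : β → Set X), IsOpen R ∧ (∀ b, IsOpen (U b)) ∧ (∀ b, IsOpen (W b)) ∧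
      C ⊆ R ∪ ⋃ b ∈ K, U b ∧ (∀ b, W b ⊆ Eᶜ) ∧ Pairwise (fun b b' => Disjoint (W b) (W b')) ∧
      ∀ μ ∈ invariantMeasures G X, μ.real R ≤ ε ∧
        (∀ b ∈ K, μ.real (U b) ≤ (∫ x, (bump C n x : ℝ) ∂μ) / K.card + ε) ∧
        ∀ b ∈ K, (1 - ∫ x, (bump E n x : ℝ) ∂μ) / K.card - ε ≤ μ.real (W b) := by
  classical
  have hFne : F.Nonempty := by
    rw [← Finset.card_pos]
    have : (0 : ℝ) < F.card := lt_of_lt_of_le (by positivity) hF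
    exact_mod_cast this
  -- With levels of diameter below `(1 / 2) ^ n`, the bump of `C` (or `E`) is 1 on every level
  -- meeting that set. `δ ≤ 1` serves the height estimate.
  obtain ⟨δ, hδ, hδε, hδ1, hδn⟩ : ∃ δ : ℝ, 0 < δ ∧ δ ≤ ε / 2 ∧ δ ≤ 1 ∧ δ ≤ (1 / 2) ^ n :=
    ⟨min (min (ε / 2) 1) ((1 / 2) ^ n), by positivity, (min_le_left _ _).trans (min_le_left _ _),
      (min_le_left _ _).trans (min_le_right _ _), min_le_right _ _⟩
  obtain ⟨m, S, V, R, hc, hS, hd, hR, hcov, hRμ⟩ := h.exists_castle hFne hδ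
  let T : Fin m → Finset G := fun i => {s ∈ S i | ((s • V i) ∩ C).Nonempty}
  let T' : Fin m → Finset G := fun i => {s ∈ S i | s • V i ⊆ Eᶜ}
  choose c hcK hc1 using fun i => exists_balanced_coloring (T i) hK
  choose c' hcK' hc1' using fun i => exists_balanced_coloring (T' i) hK
  have hsub1 : ∀ b i, ({s ∈ T i | c i s = b} : Finset G) ⊆ S i := fun b i =>
    (Finset.filter_subset _ _).trans (Finset.filter_subset _ _)
  have hsub2 : ∀ b i, ({s ∈ T' i | c' i s = b} : Finset G) ⊆ S i := fun b i =>
    (Finset.filter_subset _ _).trans (Finset.filter_subset _ _)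
  have hopen : ∀ (Q : Fin m → Finset G), IsOpen (⋃ i, ⋃ s ∈ Q i, s • V i) := fun Q =>
    isOpen_iUnion fun i => isOpen_iUnion fun s => isOpen_iUnion fun _ => (hc.1 i).smul s
  refine ⟨R, fun b => ⋃ i, ⋃ s ∈ ({s ∈ T i | c i s = b} : Finset G), s • V i,
    fun b => ⋃ i, ⋃ s ∈ ({s ∈ T' i | c' i s = b} : Finset G), s • V i, hR,
    fun b => hopen _, fun b => hopen _, ?_, ?_, ?_, ?_⟩
  · intro x hx
    rcases hcov x with hxR | ⟨i, s, hs, hxs⟩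
    · exact Or.inl hxR
    · right
      simp only [Set.mem_iUnion, exists_prop]
      exact ⟨c i s, hcK i s, i, s, Finset.mem_filter.2 ⟨Finset.mem_filter.2 ⟨hs, x, hxs, hx⟩, rfl⟩,
        hxs⟩
  · intro b
    refine Set.iUnion_subset fun i => Set.iUnion₂_subset fun s hs => ?_
    exact (Finset.mem_filter.1 (Finset.mem_filter.1 hs).1).2
  · intro b b' hbb'
    rw [Set.disjoint_left]
    intro x hx hx'
    simp only [Set.mem_iUnion, exists_prop] at hx hx'
    obtain ⟨i, s, hs, hxs⟩ := hx
    obtain ⟨j, t, ht, hxt⟩ := hx'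
    refine Set.disjoint_left.1 (hc.2 i j s (hsub2 _ _ hs) t (hsub2 _ _ ht) ?_) hxs hxt
    by_contra! hne
    obtain ⟨rfl, rfl⟩ := hne
    exact hbb' ((Finset.mem_filter.1 hs).2.symm.trans (Finset.mem_filter.1 ht).2)
  · intro μ hμ
    have hprob : IsProbabilityMeasure μ := hμ.1
    have hq : (0 : ℝ) < K.card := by exact_mod_cast hK.card_pos
    have hq1 : (1 : ℝ) ≤ K.card := by exact_mod_cast hK.card_pos
    -- From 4/ε ≤ |F| ≤ (1 + δ)|S i| ≤ 2|S i| all towers have height at least 2/ε. A colouring errs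
    -- by at most one level per tower, so the total rounding error is at most the measure of the
    -- bases.
    have hbase : ∑ i, μ.real (V i) ≤ ε / 2 := by
      have h1 := hc.sum_card_mul_measureReal_le hμ
      have h2 : ∀ i, 2 / ε ≤ (S i).card := fun i => by
        have h3 := (hS i).card_le
        have h4 : (4 / ε) = 2 * (2 / ε) := by ring
        have h5 : (1 + δ) * (S i).card ≤ 2 * (S i).card := by gcongr; linarith
        linarith
      have h6 : (2 / ε) * ∑ i, μ.real (V i) ≤ 1 := by
        rw [Finset.mul_sum]
        refine (Finset.sum_le_sum fun i _ => ?_).trans h1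
        exact mul_le_mul_of_nonneg_right (h2 i) measureReal_nonneg
      rw [div_mul_eq_mul_div, div_le_one hε] at h6
      linarith
    have hdiv : ∀ Q : Fin m → Finset G, (∀ i, Q i ⊆ S i) →
        ∑ i, ((Q i).card : ℝ) / K.card * μ.real (V i) =
          μ.real (⋃ i, ⋃ s ∈ Q i, s • V i) / K.card := by
      intro Q hQ
      rw [hc.measureReal_iUnion hμ hQ, Finset.sum_div]
      exact Finset.sum_congr rfl fun i _ => by ring
    refine ⟨(hRμ μ hμ).trans (by linarith), fun b hb => ?_, fun b hb => ?_⟩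
    · rw [hc.measureReal_iUnion hμ (hsub1 b)]
      have h1 : μ.real (⋃ i, ⋃ s ∈ T i, s • V i) ≤ ∫ x, (bump C n x : ℝ) ∂μ := by
        rw [← integral_indicator_one (hopen T).measurableSet]
        refine integral_mono ((integrable_const (1 : ℝ)).indicator (hopen T).measurableSet)
          (integrable_bump _ _ _) ?_
        refine Set.indicator_le' (fun x hx => ?_) (fun x _ => NNReal.coe_nonneg _)
        simp only [Set.mem_iUnion, exists_prop] at hx
        obtain ⟨i, s, hs, hxs⟩ := hx
        obtain ⟨hs1, y, hys, hyC⟩ := Finset.mem_filter.1 hs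
        have : bump C n x = 1 := bump_eq_one (Metric.mem_cthickening_of_dist_le _ y _ _ hyC
          ((dist_le_diam_of_compactSpace hxs hys).trans ((hd i s hs1).le.trans hδn)))
        simp [this]
      calc _ ≤ ∑ i, (((T i).card : ℝ) / K.card + 1) * μ.real (V i) := by
            refine Finset.sum_le_sum fun i _ => mul_le_mul_of_nonneg_right ?_ measureReal_nonneg
            linarith [(abs_le.1 (hc1 i b hb)).2]
        _ = μ.real (⋃ i, ⋃ s ∈ T i, s • V i) / K.card + ∑ i, μ.real (V i) := by
            rw [← hdiv T fun i => Finset.filter_subset _ _, ← Finset.sum_add_distrib]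
            exact Finset.sum_congr rfl fun i _ => by ring
        _ ≤ _ := by
            gcongr
            linarith
    · rw [hc.measureReal_iUnion hμ (hsub2 b)]
      have h1 : 1 - ∫ x, (bump E n x : ℝ) ∂μ ≤ μ.real (⋃ i, ⋃ s ∈ T' i, s • V i) + δ := by
        have h2 : 1 - ∫ x, (bump E n x : ℝ) ∂μ = ∫ x, (1 - (bump E n x : ℝ)) ∂μ := by
          rw [integral_sub (integrable_const _) (integrable_bump _ _ _)]
          simp
        -- A level not counted in `T'` meets `E`, so off `R` the integrand vanishes outside the
        -- counted levels.
        have h3 : ∫ x, (1 - (bump E n x : ℝ)) ∂μ ≤ μ.real ((⋃ i, ⋃ s ∈ T' i, s • V i) ∪ R) := by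
          have hm := ((hopen T').union hR).measurableSet
          rw [← integral_indicator_one hm]
          refine integral_mono ((integrable_const _).sub (integrable_bump _ _ _))
            ((integrable_const (1 : ℝ)).indicator hm) ?_
          refine Set.le_indicator (fun x _ => ?_) (fun x hx => ?_)
          · have := (bump E n x).coe_nonneg
            simp
          · rw [Set.mem_union, not_or] at hx
            obtain ⟨i, s, hs, hxs⟩ := (hcov x).resolve_left hx.2
            have h4 : s ∉ T' i := fun hsT => hx.1 (by
              simp only [Set.mem_iUnion, exists_prop]
              exact ⟨i, s, hsT, hxs⟩)
            have h5 : ¬ s • V i ⊆ Eᶜ := fun h' => h4 (Finset.mem_filter.2 ⟨hs, h'⟩)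
            obtain ⟨y, hys, hyE⟩ := Set.not_subset.1 h5
            have : bump E n x = 1 := bump_eq_one (Metric.mem_cthickening_of_dist_le _ y _ _
              (not_not.1 hyE)
              ((dist_le_diam_of_compactSpace hxs hys).trans ((hd i s hs).le.trans hδn)))
            simp [this]
        have h4 := measureReal_union_le (μ := μ) (⋃ i, ⋃ s ∈ T' i, s • V i) R
        have h5 := hRμ μ hμ
        linarith
      calc (1 - ∫ x, (bump E n x : ℝ) ∂μ) / K.card - ε
          ≤ (μ.real (⋃ i, ⋃ s ∈ T' i, s • V i) + δ) / K.card - ε := by gcongr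
        _ ≤ μ.real (⋃ i, ⋃ s ∈ T' i, s • V i) / K.card - ∑ i, μ.real (V i) := by
            rw [add_div]
            have : δ / K.card ≤ δ := div_le_self hδ.le hq1
            linarith
        _ = ∑ i, (((T' i).card : ℝ) / K.card - 1) * μ.real (V i) := by
            rw [← hdiv T' fun i => Finset.filter_subset _ _, ← Finset.sum_sub_distrib]
            exact Finset.sum_congr rfl fun i _ => by ring
        _ ≤ _ := by
            refine Finset.sum_le_sum fun i _ => mul_le_mul_of_nonneg_right ?_ measureReal_nonneg
            linarith [(abs_le.1 (hc1' i b hb)).1]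

end Division

/-! ### Comparison for actions with good subgroups. -/

section Comparison

lemma exists_finset_card_eq {α : Type*} {N : ℕ} (h : (N : ℕ∞) ≤ ENat.card α) :
    ∃ F : Finset α, F.card = N := by
  rw [← Set.encard_univ] at h
  obtain ⟨t, -, ht⟩ := Set.exists_subset_encard_eq h
  have hfin : t.Finite := Set.finite_of_encard_eq_coe ht
  refine ⟨hfin.toFinset, ?_⟩
  have := hfin.encard_eq_coe_toFinset_card
  rw [ht] at this
  exact_mod_cast this.symm

variable {Γ X : Type*} [Group Γ] [MetricSpace X] [CompactSpace X] [MeasurableSpace X]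
  [BorelSpace X] [MulAction Γ X] [ContinuousConstSMul Γ X]

instance (Λ : Subgroup Γ) : ContinuousConstSMul Λ X :=
  ⟨fun l => continuous_const_smul (l : Γ)⟩

lemma map_smul_mem_invariantMeasures {Λ₁ Λ₂ : Subgroup Γ} {g : Γ}
    (h : ∀ l ∈ Λ₁, g⁻¹ * l * g ∈ Λ₂) {ν : Measure X} (hν : ν ∈ invariantMeasures Λ₂ X) :
    ν.map (fun x => g • x) ∈ invariantMeasures Λ₁ X := by
  obtain ⟨_, _, _⟩ := hν
  have hm : ∀ g : Γ, Measurable (fun x : X => g • x) := fun g =>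
    (continuous_const_smul g).measurable
  have hp : IsProbabilityMeasure (ν.map (fun x => g • x)) :=
    Measure.isProbabilityMeasure_map (hm g).aemeasurable
  refine ⟨hp, inferInstance, ⟨fun l s hs => ?_⟩⟩
  rw [Measure.map_apply (hm g) hs, Measure.map_apply (hm g)
    (show MeasurableSet ((fun x => l • x) ⁻¹' s) from hm (l : Γ) hs)]
  have h1 := measure_preimage_smul ν (⟨_, h l l.2⟩ : Λ₂) ((fun x => g • x) ⁻¹' s)
  rw [← h1]
  congr 1
  ext x
  simp [Subgroup.smul_def, smul_smul, mul_assoc]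

lemma measureReal_map_smul (ν : Measure X) (g : Γ) {A : Set X} (hA : IsOpen A) :
    (ν.map (fun x => g • x)).real A = ν.real (g⁻¹ • A) := by
  rw [map_measureReal_apply (continuous_const_smul g).measurable hA.measurableSet,
    Set.preimage_smul]

/-- Comparison of a closed set with an open set, for actions with good subgroups. -/
theorem HasGoodSubgroups.exists_disjoint_translates (hgood : HasGoodSubgroups Γ X)
    (hΓ : IsAmenable Γ) {C V : Set X} (hC : IsClosed C) (hV : IsOpen V)
    (hlt : ∀ μ ∈ invariantMeasures Γ X, μ.real C < μ.real V) :
    ∃ (n : ℕ) (U : Fin n → Set X) (s : Fin n → Γ),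
      (∀ j, IsOpen (U j)) ∧ C ⊆ ⋃ j, U j ∧ (∀ j, s j • U j ⊆ V) ∧
      Pairwise fun j k => Disjoint (s j • U j) (s k • U k) := by
  classical
  obtain ⟨S, n, η, hS, hη, hsum⟩ := exists_averaging_set hΓ hC hV.isClosed_compl (fun μ hμ => by
    have := hlt μ hμ
    have hp := hμ.1
    rw [probReal_compl_eq_one_sub hV.measurableSet]
    linarith)
  have hq : (0 : ℝ) < S.card := by exact_mod_cast hS.card_pos
  have hq1 : (1 : ℝ) ≤ S.card := by exact_mod_cast hS.card_pos
  -- There are 2|S| + 1 errors of size `ε` below, at most 3η/4 in total, which is less than the gap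
  -- `η`.
  set ε : ℝ := η / (4 * S.card) with hε_def
  have hε : 0 < ε := by positivity
  have hεη : S.card * ε = η / 4 := by rw [hε_def]; field_simp
  obtain ⟨Λ₁, Λ₂, hle, hN, -, haf, hcomp, hconj⟩ := hgood S⁻¹ ⌈4 / ε⌉₊
  obtain ⟨F, hF⟩ := exists_finset_card_eq hN
  obtain ⟨R, U, W, hR, hU, hW, hcov, hWV, hWd, hμ⟩ := haf.exists_division C Vᶜ n hS hε (F := F)
    (by rw [hF]; exact Nat.le_ceil _)
  let g : Fin S.card → Γ := fun k => (S.equivFin.symm k : S)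
  have hginj : Function.Injective g := fun k k' h => S.equivFin.symm.injective (Subtype.ext h)
  have hgsurj : ∀ b ∈ S, ∃ k, g k = b := fun b hb => ⟨S.equivFin ⟨b, hb⟩, by simp [g]⟩
  have hgsum : ∀ φ : Γ → ℝ, ∑ k, φ (g k) = ∑ b ∈ S, φ b := fun φ => by
    rw [← Finset.sum_coe_sort S, ← Equiv.sum_comp S.equivFin.symm]
  -- Index 0 carries the remainder `R`, which is not translated; its estimate uses that `ν` itself
  -- is Λ₁-invariant.
  let A : Fin (S.card + 1) → Set X := Fin.cons R fun k => U (g k)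
  let h : Fin (S.card + 1) → Γ := Fin.cons 1 g
  have hA : ∀ i, IsOpen (A i) := Fin.cases hR fun k => hU _
  -- Subequivalence needs a closed set inside each summand, so `C` is split into compact pieces
  -- subordinate to the cover.
  obtain ⟨Q, hQc, hQA, hQ⟩ := hC.isCompact.finite_compact_cover Finset.univ A (fun i _ => hA i)
    (fun x hx => by
      rcases hcov hx with hxR | hxU
      · exact Set.mem_biUnion (Finset.mem_univ 0) hxR
      · simp only [Set.mem_iUnion, exists_prop] at hxU
        obtain ⟨b, hb, hxb⟩ := hxU
        obtain ⟨k, rfl⟩ := hgsurj b hb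
        exact Set.mem_biUnion (Finset.mem_univ k.succ) hxb)
  have hmain : ∀ ν ∈ invariantMeasures Λ₂ X,
      ∑ i, ν ((h i)⁻¹ • A i) < ∑ k, ν ((g k)⁻¹ • W (g k)) := by
    intro ν hν
    have hνp : IsProbabilityMeasure ν := hν.1
    have hν1 : ν ∈ invariantMeasures Λ₁ X := by
      have := map_smul_mem_invariantMeasures (Λ₁ := Λ₁) (Λ₂ := Λ₂) (g := 1)
        (by simpa using fun l hl => hle hl) hν
      simpa using this
    have hmap : ∀ b ∈ S, ν.map (fun x => b • x) ∈ invariantMeasures Λ₁ X := fun b hb =>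
      map_smul_mem_invariantMeasures (fun l hl => by
        simpa using hconj b⁻¹ (by simpa using hb) l hl) hν
    have hint : ∀ (E : Set X) (b : Γ), ∫ x, (bump E n x : ℝ) ∂(ν.map fun x => b • x) =
        ∫ x, (bump E n (b • x) : ℝ) ∂ν := fun E b =>
      integral_map (continuous_const_smul b).measurable.aemeasurable
        (NNReal.continuous_coe.comp (bump E n).continuous).aestronglyMeasurable
    have hi : ∀ (E : Set X) (b : Γ), Integrable (fun x => (bump E n (b • x) : ℝ)) ν := fun E b =>
      (integrable_bump (ν.map fun x => b • x) E n).comp_measurable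
        (continuous_const_smul b).measurable
    have hadd : ∀ b, Integrable (fun x => (bump C n (b • x) : ℝ) + bump Vᶜ n (b • x)) ν :=
      fun b => (hi C b).add (hi Vᶜ b)
    have havg : ∑ b ∈ S, (∫ x, (bump C n (b • x) : ℝ) ∂ν + ∫ x, (bump Vᶜ n (b • x) : ℝ) ∂ν) ≤
        (1 - η) * S.card := by
      have h1 : ∑ b ∈ S, (∫ x, (bump C n (b • x) : ℝ) ∂ν + ∫ x, (bump Vᶜ n (b • x) : ℝ) ∂ν) =
          ∫ x, ∑ b ∈ S, ((bump C n (b • x) : ℝ) + bump Vᶜ n (b • x)) ∂ν := by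
        rw [integral_finsetSum _ fun b _ => hadd b]
        exact Finset.sum_congr rfl fun b _ => (integral_add (hi C b) (hi Vᶜ b)).symm
      rw [h1]
      refine (integral_mono (integrable_finsetSum _ fun b _ => hadd b)
        (integrable_const _) hsum).trans ?_
      simp
    have hUle : ∀ b ∈ S, ν.real (b⁻¹ • U b) ≤
        (∫ x, (bump C n (b • x) : ℝ) ∂ν) / S.card + ε := fun b hb => by
      rw [← measureReal_map_smul ν b (hU b), ← hint]
      exact (hμ _ (hmap b hb)).2.1 b hb
    have hWle : ∀ b ∈ S, (1 - ∫ x, (bump Vᶜ n (b • x) : ℝ) ∂ν) / S.card - ε ≤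
        ν.real (b⁻¹ • W b) := fun b hb => by
      rw [← measureReal_map_smul ν b (hW b), ← hint]
      exact (hμ _ (hmap b hb)).2.2 b hb
    have hreal : ∑ i, ν.real ((h i)⁻¹ • A i) < ∑ k, ν.real ((g k)⁻¹ • W (g k)) := by
      rw [Fin.sum_univ_succ]
      simp only [h, A, Fin.cons_zero, Fin.cons_succ, inv_one, one_smul]
      rw [hgsum fun b => ν.real (b⁻¹ • U b), hgsum fun b => ν.real (b⁻¹ • W b)]
      have h1 := Finset.sum_le_sum hUle
      have h2 := Finset.sum_le_sum hWle
      have h3 := (hμ ν hν1).1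
      rw [Finset.sum_add_distrib, ← Finset.sum_div, Finset.sum_const, nsmul_eq_mul, hεη] at h1
      rw [Finset.sum_sub_distrib, ← Finset.sum_div, Finset.sum_sub_distrib, Finset.sum_const,
        Finset.sum_const, nsmul_eq_mul, nsmul_eq_mul, mul_one, hεη, sub_div,
        div_self hq.ne'] at h2
      rw [Finset.sum_add_distrib, ← div_le_iff₀ hq, add_div] at havg
      have h4 : ε ≤ η / 4 := by
        rw [← hεη]
        exact le_mul_of_one_le_left hε.le hq1
      linarith
    simp only [measureReal_def] at hreal
    rwa [← ENNReal.toReal_sum fun i _ => measure_ne_top _ _,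
      ← ENNReal.toReal_sum fun i _ => measure_ne_top _ _, ENNReal.toReal_lt_toReal] at hreal
    · exact (ENNReal.sum_lt_top.2 fun i _ => measure_lt_top _ _).ne
    · exact (ENNReal.sum_lt_top.2 fun i _ => measure_lt_top _ _).ne
  obtain ⟨m, O, s, a, b, hO, hcovO, hsub, hdisj⟩ := hcomp _ _ _ _
    (fun i => (hA i).smul _) (fun k => (hW _).smul _) hmain (fun i => (h i)⁻¹ • Q i)
    (fun i => ((hQc i).isClosed.smul _)) (fun i => Set.smul_set_mono (hQA i))
  -- Undo the translations on both sides: from `U_b` go down by `h⁻¹`, apply the element of Λ₂, and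
  -- return by `g (b j)`.
  have hkey : ∀ j, (g (b j) * s j * (h (a j))⁻¹) • h (a j) • O j = g (b j) • s j • O j := fun j => by
    rw [smul_smul, inv_mul_cancel_right, mul_smul]
    rfl
  have hsub' : ∀ j, g (b j) • s j • O j ⊆ W (g (b j)) := fun j => by
    have := hsub j
    rwa [Set.subset_smul_set_iff, inv_inv] at this
  refine ⟨m, fun j => h (a j) • O j, fun j => g (b j) * s j * (h (a j))⁻¹,
    fun j => (hO j).smul _, fun x hx => ?_, fun j => ?_, fun j k hjk => ?_⟩
  · rw [hQ] at hx
    simp only [Set.mem_iUnion, Finset.mem_univ, exists_prop, true_and] at hx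
    obtain ⟨i, hi⟩ := hx
    have := hcovO i (Set.smul_mem_smul_set hi)
    simp only [Set.mem_iUnion, exists_prop] at this ⊢
    obtain ⟨j, rfl, hj⟩ := this
    exact ⟨j, by rwa [Set.mem_smul_set_iff_inv_smul_mem]⟩
  · rw [hkey]
    exact (hsub' j).trans ((hWV _).trans (compl_compl V).subset)
  · simp only [hkey]
    -- Images in the same `W_b` are disjoint by multiset comparison; different `W_b` are disjoint by
    -- construction.
    by_cases hb : b j = b k
    · rw [← hb, Set.disjoint_smul_set]
      exact hdisj j k hjk hb
    · exact (hWd fun h' => hb (hginj h')).mono (hsub' j) (hsub' k)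

theorem HasGoodSubgroups.hasComparison (hgood : HasGoodSubgroups Γ X) (hΓ : IsAmenable Γ) :
    HasComparison Γ X := by
  intro U V _ hV hlt C hC hCU
  refine hgood.exists_disjoint_translates hΓ hC hV fun μ hμ => ?_
  have := hμ.1
  refine (measureReal_mono hCU).trans_lt ?_
  rw [measureReal_def, measureReal_def, ENNReal.toReal_lt_toReal (measure_ne_top _ _)
    (measure_ne_top _ _)]
  exact hlt μ hμ

end Comparison

/-! ### The small boundary property. -/

section SmallBoundary

variable {G X : Type*} [Group G] [MetricSpace X] [CompactSpace X] [MeasurableSpace X]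
  [BorelSpace X] [MulAction G X] [ContinuousConstSMul G X]

lemma exists_le_dist_cthickening {C C' : Set X} (hC : IsClosed C) (hC' : IsClosed C')
    (hd : Disjoint C C') :
    ∃ δ : ℝ, 0 < δ ∧ ∀ x ∈ Metric.cthickening δ C, ∀ y ∈ Metric.cthickening δ C', δ ≤ dist x y := by
  obtain ⟨r, hr, hdr⟩ := hd.exists_thickenings hC.isCompact hC'
  refine ⟨r / 3, by positivity, fun x hx y hy => ?_⟩
  by_contra! h
  have h1 : y ∈ Metric.cthickening (r / 3 + r / 3) C :=
    Metric.cthickening_cthickening_subset (by positivity) (by positivity) C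
      (Metric.mem_cthickening_of_dist_le y x _ _ hx (by rw [dist_comm]; exact h.le))
  exact Set.disjoint_left.1 hdr (Metric.cthickening_subset_thickening' hr (by linarith) _ h1)
    (Metric.cthickening_subset_thickening' hr (by linarith) _ hy)

/-- Disjoint closed sets can be enlarged to disjoint closed sets that miss only a set of small
measure. -/
lemma IsAlmostFinite.exists_closed_enlargements (h : IsAlmostFinite G X) {C C' : Set X}
    (hC : IsClosed C) (hC' : IsClosed C') (hd : Disjoint C C') {η : ℝ} (hη : 0 < η) :
    ∃ D D' : Set X, IsClosed D ∧ IsClosed D' ∧ Disjoint D D' ∧ C ⊆ interior D ∧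
      C' ⊆ interior D' ∧ ∀ μ ∈ invariantMeasures G X, μ.real (D ∪ D')ᶜ ≤ η := by
  obtain ⟨δ, hδ, hdist⟩ := exists_le_dist_cthickening hC hC' hd
  obtain ⟨n, S, V, R, hc, -, hdiam, hR, hcov, hμ⟩ :=
    h.exists_castle (F := {1}) (by simp) (lt_min hδ hη)
  have hdiam' : ∀ i, ∀ s ∈ S i, Metric.diam (s • V i) < δ := fun i s hs =>
    (hdiam i s hs).trans_le (min_le_left _ _)
  set N := Metric.cthickening δ C
  set N' := Metric.cthickening δ C'
  -- Each level goes to one side according to whether it meets `N`. By the choice of `δ`, a level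
  -- meeting `N` cannot meet `N'`.
  let L : Set X := ⋃ i, ⋃ s ∈ S i, ⋃ _ : (s • V i ∩ N).Nonempty, s • V i
  let L' : Set X := ⋃ i, ⋃ s ∈ S i, ⋃ _ : ¬ (s • V i ∩ N).Nonempty, s • V i
  have hL : IsOpen L := isOpen_iUnion fun i => isOpen_iUnion fun s => isOpen_iUnion fun _ =>
    isOpen_iUnion fun _ => (hc.1 i).smul s
  have hL' : IsOpen L' := isOpen_iUnion fun i => isOpen_iUnion fun s => isOpen_iUnion fun _ =>
    isOpen_iUnion fun _ => (hc.1 i).smul s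
  have hmemL : ∀ x, x ∈ L ↔ ∃ i, ∃ s ∈ S i, (s • V i ∩ N).Nonempty ∧ x ∈ s • V i := fun x => by
    simp only [L, Set.mem_iUnion, exists_prop]
  have hmemL' : ∀ x, x ∈ L' ↔ ∃ i, ∃ s ∈ S i, ¬ (s • V i ∩ N).Nonempty ∧ x ∈ s • V i := fun x => by
    simp only [L', Set.mem_iUnion, exists_prop]
  have hcovL : ∀ x, x ∉ R → x ∈ L ∨ x ∈ L' := fun x hx => by
    obtain ⟨i, s, hs, hxs⟩ := (hcov x).resolve_left hx
    by_cases hN : (s • V i ∩ N).Nonempty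
    · exact Or.inl ((hmemL x).2 ⟨i, s, hs, hN, hxs⟩)
    · exact Or.inr ((hmemL' x).2 ⟨i, s, hs, hN, hxs⟩)
  have hLL' : ∀ x, x ∈ L → x ∉ L' := fun x hx hx' => by
    obtain ⟨i, s, hs, hN, hxs⟩ := (hmemL x).1 hx
    obtain ⟨j, t, ht, hN', hxt⟩ := (hmemL' x).1 hx'
    refine Set.disjoint_left.1 (hc.2 i j s hs t ht ?_) hxs hxt
    by_contra! hne
    obtain ⟨rfl, rfl⟩ := hne
    exact hN' hN
  have hsub : ∀ E : Set X, E ⊆ interior (Metric.cthickening δ E) := fun E =>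
    (Metric.self_subset_thickening hδ E).trans
      (interior_maximal (Metric.thickening_subset_cthickening _ _) Metric.isOpen_thickening)
  -- Off `R` the open sets `L` and `L'` partition the space, so removing `R` and one of them leaves
  -- a closed part of the other. Only `R` can be missed.
  refine ⟨N ∪ (R ∪ L')ᶜ, N' ∪ (R ∪ L)ᶜ, Metric.isClosed_cthickening.union
    (hR.union hL').isClosed_compl, Metric.isClosed_cthickening.union
    (hR.union hL).isClosed_compl, ?_, (hsub C).trans (interior_mono Set.subset_union_left),
    (hsub C').trans (interior_mono Set.subset_union_left), fun μ hμ' => ?_⟩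
  · rw [Set.disjoint_left]
    intro x hx hx'
    simp only [Set.mem_union, Set.mem_compl_iff, not_or] at hx hx'
    rcases hx with hx | ⟨hxR, hxL'⟩
    · rcases hx' with hx' | ⟨hxR, hxL⟩
      · have := hdist x hx x hx'
        simp only [dist_self] at this
        linarith
      · obtain ⟨i, s, hs, hN, hxs⟩ := (hmemL' x).1 ((hcovL x hxR).resolve_left hxL)
        exact hN ⟨x, hxs, hx⟩
    · rcases hx' with hx' | ⟨-, hxL⟩
      · obtain ⟨i, s, hs, ⟨y, hys, hyN⟩, hxs⟩ := (hmemL x).1 ((hcovL x hxR).resolve_right hxL')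
        have h1 := hdist y hyN x hx'
        have h2 := dist_le_diam_of_compactSpace hys hxs
        have h3 := hdiam' i s hs
        linarith
      · exact (hcovL x hxR).elim hxL hxL'
  · have := hμ'.1
    refine (measureReal_mono (fun x hx => ?_)).trans ((hμ μ hμ').trans (min_le_right _ _))
    by_contra hxR
    simp only [Set.mem_compl_iff, Set.mem_union, not_or, not_and, not_not] at hx
    have h1 := hx.1.2 hxR
    have h2 := hx.2.2 hxR
    exact hLL' x h2 h1

/-- Almost finite actions have the small boundary property. -/
theorem IsAlmostFinite.exists_open_null_frontier (h : IsAlmostFinite G X) {C U : Set X}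
    (hC : IsClosed C) (hU : IsOpen U) (hCU : C ⊆ U) :
    ∃ O : Set X, IsOpen O ∧ C ⊆ O ∧ O ⊆ U ∧
      ∀ μ ∈ invariantMeasures G X, μ (frontier O) = 0 := by
  let P := {p : Set X × Set X // IsClosed p.1 ∧ IsClosed p.2 ∧ Disjoint p.1 p.2}
  have hstep : ∀ (k : ℕ) (p : P), ∃ p' : P, p.1.1 ⊆ interior p'.1.1 ∧ p.1.2 ⊆ interior p'.1.2 ∧
      ∀ μ ∈ invariantMeasures G X, μ.real (p'.1.1 ∪ p'.1.2)ᶜ ≤ 1 / ((k : ℝ) + 1) := by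
    rintro k ⟨p, h1, h2, h3⟩
    obtain ⟨D, D', hD, hD', hdis, hCD, hCD', hμ⟩ :=
      h.exists_closed_enlargements h1 h2 h3 (η := 1 / ((k : ℝ) + 1)) (by positivity)
    exact ⟨⟨(D, D'), hD, hD', hdis⟩, hCD, hCD', hμ⟩
  choose f hf1 hf2 hf3 using hstep
  -- The two closed sets grow, each inside the interior of the next. The boundary of the union of
  -- the first ones avoids both sets at every stage, so its measure is at most 1/(k + 1) for all k.
  let p : ℕ → P := fun k => Nat.rec ⟨(C, Uᶜ), hC, hU.isClosed_compl,
    Set.disjoint_compl_right_iff_subset.2 hCU⟩ (fun k q => f k q) k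
  have hp1 : ∀ k, (p k).1.1 ⊆ interior (p (k + 1)).1.1 := fun k => hf1 k (p k)
  have hp2 : ∀ k, (p k).1.2 ⊆ interior (p (k + 1)).1.2 := fun k => hf2 k (p k)
  have hm1 : Monotone fun k => (p k).1.1 :=
    monotone_nat_of_le_succ fun k => (hp1 k).trans interior_subset
  have hm2 : Monotone fun k => (p k).1.2 :=
    monotone_nat_of_le_succ fun k => (hp2 k).trans interior_subset
  let O := ⋃ k, interior (p k).1.1
  let O' := ⋃ k, interior (p k).1.2
  have hO : IsOpen O := isOpen_iUnion fun k => isOpen_interior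
  have hO' : IsOpen O' := isOpen_iUnion fun k => isOpen_interior
  have hsubO : ∀ k, (p k).1.1 ⊆ O := fun k =>
    (hp1 k).trans (Set.subset_iUnion (fun k => interior (p k).1.1) (k + 1))
  have hsubO' : ∀ k, (p k).1.2 ⊆ O' := fun k =>
    (hp2 k).trans (Set.subset_iUnion (fun k => interior (p k).1.2) (k + 1))
  have hdis : Disjoint O O' := by
    rw [Set.disjoint_left]
    intro x hx hx'
    obtain ⟨k, hk⟩ := Set.mem_iUnion.1 hx
    obtain ⟨l, hl⟩ := Set.mem_iUnion.1 hx'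
    exact Set.disjoint_left.1 (p (max k l)).2.2.2 (hm1 (le_max_left k l) (interior_subset hk))
      (hm2 (le_max_right k l) (interior_subset hl))
  refine ⟨O, hO, hsubO 0, fun x hx => ?_, fun μ hμ => ?_⟩
  · by_contra hxU
    exact Set.disjoint_left.1 hdis hx (hsubO' 0 hxU)
  · have hprob := hμ.1
    rw [← measureReal_eq_zero_iff]
    refine le_antisymm (ge_of_tendsto' tendsto_one_div_add_atTop_nhds_zero_nat fun k => ?_)
      measureReal_nonneg
    refine (measureReal_mono ?_).trans (hf3 k (p k) μ hμ)
    intro x hx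
    rw [hO.frontier_eq] at hx
    intro hx'
    rcases hx' with hx' | hx'
    · exact hx.2 (hsubO (k + 1) hx')
    · exact Set.disjoint_left.1 (hdis.closure_left hO') hx.1 (hsubO' (k + 1) hx')

variable (G) in
/-- A measurable set whose boundary is null for all invariant measures. -/
def NullFrontier (A : Set X) : Prop :=
  MeasurableSet A ∧ ∀ μ ∈ invariantMeasures G X, μ (frontier A) = 0

namespace NullFrontier

lemma empty : NullFrontier G (∅ : Set X) := ⟨.empty, by simp⟩

variable {A B : Set X}

lemma compl (h : NullFrontier G A) : NullFrontier G Aᶜ :=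
  ⟨h.1.compl, by simpa using h.2⟩

lemma inter (hA : NullFrontier G A) (hB : NullFrontier G B) : NullFrontier G (A ∩ B) :=
  ⟨hA.1.inter hB.1, fun μ hμ => measure_mono_null (t := frontier A ∪ frontier B)
    ((frontier_inter_subset A B).trans
      (Set.union_subset_union Set.inter_subset_left Set.inter_subset_right))
    (measure_union_null (hA.2 μ hμ) (hB.2 μ hμ))⟩

lemma union (hA : NullFrontier G A) (hB : NullFrontier G B) : NullFrontier G (A ∪ B) := by
  simpa [Set.compl_inter] using (hA.compl.inter hB.compl).compl

lemma smul (hA : NullFrontier G A) (g : G) : NullFrontier G (g • A) := by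
  refine ⟨hA.1.const_smul g, fun μ hμ => ?_⟩
  have h1 : frontier (g • A) = g • frontier A := ((Homeomorph.smul g).image_frontier A).symm
  have := hμ.2.2
  rw [h1, measure_smul]
  exact hA.2 μ hμ

lemma biUnion {ι : Type*} {t : Finset ι} {A : ι → Set X} (h : ∀ i ∈ t, NullFrontier G (A i)) :
    NullFrontier G (⋃ i ∈ t, A i) := by
  classical
  induction t using Finset.induction_on with
  | empty => simpa using empty
  | insert i t _ ih =>
    rw [Finset.set_biUnion_insert]
    exact (h i (by simp)).union (ih fun j hj => h j (by simp [hj]))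

lemma biInter {ι : Type*} {t : Finset ι} {A : ι → Set X} (h : ∀ i ∈ t, NullFrontier G (A i)) :
    NullFrontier G (⋂ i ∈ t, A i) := by
  simpa [Set.compl_iUnion] using (biUnion (A := fun i => (A i)ᶜ) fun i hi => (h i hi).compl).compl

/-- Lets measurable castles be replaced by open ones at no cost. -/
lemma measureReal_interior (hA : NullFrontier G A) {μ : Measure X}
    (hμ : μ ∈ invariantMeasures G X) : μ.real (interior A) = μ.real A := by
  have := hμ.1
  refine le_antisymm (measureReal_mono interior_subset) ?_
  have h1 : A ⊆ interior A ∪ frontier A := by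
    rw [← closure_eq_interior_union_frontier]
    exact subset_closure
  have h2 := (measureReal_mono (μ := μ) h1).trans (measureReal_union_le _ _)
  rwa [show μ.real (frontier A) = 0 by simp [measureReal_def, hA.2 μ hμ], add_zero] at h2

end NullFrontier

/-- Measures invariant under the whole group are invariant under any subgroup, so one almost finite
subgroup suffices. -/
lemma HasGoodSubgroups.exists_nullFrontier_nhds (hgood : HasGoodSubgroups G X) {x : X} {U : Set X}
    (hU : U ∈ 𝓝 x) : ∃ O ∈ 𝓝 x, O ⊆ U ∧ NullFrontier G O := by
  obtain ⟨Λ₁, -, -, -, -, haf, -⟩ := hgood ∅ 0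
  obtain ⟨U', hU'U, hU', hxU'⟩ := mem_nhds_iff.1 hU
  obtain ⟨O, hO, hxO, hOU, hOμ⟩ := haf.exists_open_null_frontier (isClosed_singleton (x := x)) hU'
    (by simpa using hxU')
  refine ⟨O, hO.mem_nhds (hxO rfl), hOU.trans hU'U, hO.measurableSet, fun μ hμ => hOμ μ ?_⟩
  obtain ⟨h1, h2, h3⟩ := hμ
  exact ⟨h1, h2, inferInstance⟩

lemma IsFree.eventually_smallSets_disjoint (hfree : IsFree G X) (x : X) {g h : G} (hgh : g ≠ h) :
    ∀ᶠ U in (𝓝 x).smallSets, Disjoint (g • U) (h • U) := by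
  have hne : g • x ≠ h • x := fun heq => hgh (by
    have := hfree (h⁻¹ * g) x (by rw [mul_smul, heq, inv_smul_smul])
    rwa [inv_mul_eq_one, eq_comm] at this)
  obtain ⟨A, B, hA, hB, hxA, hxB, hAB⟩ := t2_separation hne
  rw [eventually_smallSets]
  refine ⟨g⁻¹ • A ∩ h⁻¹ • B, inter_mem ((hA.smul _).mem_nhds ?_) ((hB.smul _).mem_nhds ?_),
    fun U hU => hAB.mono ?_ ?_⟩
  · rwa [Set.mem_inv_smul_set_iff]
  · rwa [Set.mem_inv_smul_set_iff]
  · rw [Set.smul_set_subset_iff_subset_inv_smul_set]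
    exact hU.trans Set.inter_subset_left
  · rw [Set.smul_set_subset_iff_subset_inv_smul_set]
    exact hU.trans Set.inter_subset_right

omit [MeasurableSpace X] [BorelSpace X] in
lemma eventually_smallSets_diam_lt (x : X) (g : G) {ε : ℝ} (hε : 0 < ε) :
    ∀ᶠ U in (𝓝 x).smallSets, Metric.diam (g • U) < ε := by
  rw [eventually_smallSets]
  refine ⟨g⁻¹ • Metric.ball (g • x) (ε / 3), (Metric.isOpen_ball.smul _).mem_nhds ?_,
    fun U hU => ?_⟩
  · rw [Set.mem_inv_smul_set_iff]
    exact Metric.mem_ball_self (by positivity)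
  · rw [← Set.smul_set_subset_iff_subset_inv_smul_set] at hU
    have h1 := Metric.diam_mono hU Metric.isBounded_ball
    have h2 := Metric.diam_ball (x := g • x) (show 0 ≤ ε / 3 by positivity)
    linarith

/-- A free action with good subgroups admits finite covers by sets with null boundaries whose
translates by a given finite set are disjoint and small. -/
lemma HasGoodSubgroups.exists_adapted_cover (hgood : HasGoodSubgroups G X) (hfree : IsFree G X)
    (K : Finset G) {ε : ℝ} (hε : 0 < ε) :
    ∃ (t : Finset X) (P : X → Set X), (∀ x, ∃ i ∈ t, x ∈ P i) ∧ ∀ i, NullFrontier G (P i) ∧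
      (∀ g ∈ K, ∀ h ∈ K, g ≠ h → Disjoint (g • P i) (h • P i)) ∧
      ∀ g ∈ K, Metric.diam (g • P i) < ε := by
  have hloc : ∀ x : X, ∃ O ∈ 𝓝 x, NullFrontier G O ∧
      (∀ g ∈ K, ∀ h ∈ K, g ≠ h → Disjoint (g • O) (h • O)) ∧ ∀ g ∈ K, Metric.diam (g • O) < ε := by
    intro x
    have h1 : ∀ᶠ U in (𝓝 x).smallSets,
        (∀ g ∈ K, ∀ h ∈ K, g ≠ h → Disjoint (g • U) (h • U)) ∧
          ∀ g ∈ K, Metric.diam (g • U) < ε := by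
      rw [eventually_and]
      simp only [Finset.eventually_all]
      refine ⟨fun g _ h _ => ?_, fun g _ => eventually_smallSets_diam_lt x g hε⟩
      by_cases hgh : g = h
      · simp [hgh]
      · exact (hfree.eventually_smallSets_disjoint x hgh).mono fun U hU _ => hU
    obtain ⟨U, hU, hUp⟩ := eventually_smallSets.1 h1
    obtain ⟨O, hO, hOU, hOn⟩ := hgood.exists_nullFrontier_nhds hU
    exact ⟨O, hO, hOn, hUp O hOU⟩
  choose P hP hP' using hloc
  obtain ⟨t, ht⟩ := CompactSpace.elim_nhds_subcover P hP
  refine ⟨t, P, fun x => ?_, hP'⟩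
  have : x ∈ ⋃ i ∈ t, P i := ht ▸ Set.mem_univ x
  simpa using this

end SmallBoundary

/-! ### Greedy tilings by castles with null boundaries. -/

section Tilings

variable {G X : Type*} [Group G] [MetricSpace X] [CompactSpace X] [MeasurableSpace X]
  [BorelSpace X] [MulAction G X] [ContinuousConstSMul G X]

/-- The sets which are the union of the levels of a castle whose shapes satisfy `Q`, whose levels
have diameter less than `ε`, and whose bases have null boundary. -/
inductive Tiled (Q : Finset G → Prop) (ε : ℝ) : Set X → Prop
  | empty : Tiled Q ε ∅
  | union {A W : Set X} {T : Finset G} (hA : Tiled Q ε A) (hW : NullFrontier G W) (hT : Q T)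
      (hd : ∀ t ∈ T, Metric.diam (t • W) < ε)
      (hdis : ∀ s ∈ T, ∀ t ∈ T, s ≠ t → Disjoint (s • W) (t • W))
      (hdisA : ∀ t ∈ T, Disjoint (t • W) A) : Tiled Q ε (A ∪ ⋃ t ∈ T, t • W)

variable {Q : Finset G → Prop} {ε : ℝ} {A : Set X}

lemma Tiled.nullFrontier (h : Tiled Q ε A) : NullFrontier G A := by
  induction h with
  | empty => exact .empty
  | union _ hW _ _ _ _ ih => exact ih.union (.biUnion fun t _ => hW.smul t)

lemma Tiled.exists_castle (h : Tiled Q ε A) :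
    ∃ (n : ℕ) (S : Fin n → Finset G) (V : Fin n → Set X), (∀ i, NullFrontier G (V i)) ∧
      (∀ i j, ∀ s ∈ S i, ∀ t ∈ S j, (i ≠ j ∨ s ≠ t) → Disjoint (s • V i) (t • V j)) ∧
      (∀ i, Q (S i)) ∧ (∀ i, ∀ s ∈ S i, Metric.diam (s • V i) < ε) ∧
      A = ⋃ i, ⋃ s ∈ S i, s • V i := by
  induction h with
  | empty => exact ⟨0, Fin.elim0, Fin.elim0, fun i => i.elim0, fun i => i.elim0, fun i => i.elim0,
      fun i => i.elim0, by simp⟩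
  | @union A W T _ hW hT hd hdis hdisA ih =>
    obtain ⟨n, S, V, h1, h2, h3, h4, rfl⟩ := ih
    have hlev : ∀ t ∈ T, ∀ j, ∀ s ∈ S j, Disjoint (t • W) (s • V j) := fun t ht j s hs =>
      (hdisA t ht).mono_right fun x hx => by
        simp only [Set.mem_iUnion, exists_prop]
        exact ⟨j, s, hs, hx⟩
    refine ⟨n + 1, Fin.cons T S, Fin.cons W V, Fin.cases hW h1, ?_, Fin.cases hT h3,
      Fin.cases hd h4, ?_⟩
    · intro i j
      induction i using Fin.cases with
      | zero =>
        induction j using Fin.cases with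
        | zero =>
          intro s hs t ht hst
          exact hdis s hs t ht (by simpa using hst)
        | succ j => exact fun s hs t ht _ => hlev s hs j t ht
      | succ i =>
        induction j using Fin.cases with
        | zero => exact fun s hs t ht _ => (hlev t ht i s hs).symm
        | succ j =>
          intro s hs t ht hst
          exact h2 i j s hs t ht (by simpa using hst)
    · ext x
      simp only [Set.mem_union, Set.mem_iUnion, exists_prop, Fin.exists_fin_succ, Fin.cons_zero,
        Fin.cons_succ]
      exact or_comm

/-- The elements of `K` that move `x` into `A`. -/
noncomputable def hits (K : Finset G) (A : Set X) (x : X) : Finset G := by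
  classical exact {g ∈ K | g • x ∈ A}

lemma mem_hits {K : Finset G} {x : X} {g : G} : g ∈ hits K A x ↔ g ∈ K ∧ g • x ∈ A := by
  simp [hits]

lemma hits_subset (K : Finset G) (A : Set X) (x : X) : hits K A x ⊆ K :=
  fun _ hg => (mem_hits.1 hg).1

lemma hits_mono (K : Finset G) {A B : Set X} (h : A ⊆ B) (x : X) : hits K A x ⊆ hits K B x :=
  fun _ hg => mem_hits.2 ⟨(mem_hits.1 hg).1, h (mem_hits.1 hg).2⟩

lemma NullFrontier.setOf_hits_eq (hA : NullFrontier G A) {P : Set X} (hP : NullFrontier G P)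
    (K T : Finset G) : NullFrontier G {x | x ∈ P ∧ hits K A x = T} := by
  classical
  by_cases hTK : T ⊆ K
  · have : {x | x ∈ P ∧ hits K A x = T} =
        P ∩ ((⋂ g ∈ T, g⁻¹ • A) ∩ ⋂ g ∈ K \ T, g⁻¹ • Aᶜ) := by
      ext x
      simp only [Set.mem_ofPred_eq, Set.mem_inter_iff, Set.mem_iInter, Set.mem_inv_smul_set_iff,
        Set.mem_compl_iff, Finset.mem_sdiff, and_imp, Finset.ext_iff, mem_hits]
      refine and_congr_right fun _ => ⟨fun h => ⟨fun g hg => ((h g).2 hg).2,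
        fun g hg hgT hgA => hgT ((h g).1 ⟨hg, hgA⟩)⟩, fun h g => ⟨fun hg => ?_, fun hg =>
        ⟨hTK hg, h.1 g hg⟩⟩⟩
      by_contra hgT
      exact h.2 g hg.1 hgT hg.2
    rw [this]
    exact hP.inter ((NullFrontier.biInter fun g _ => hA.smul _).inter
      (NullFrontier.biInter fun g _ => hA.compl.smul _))
  · have : {x | x ∈ P ∧ hits K A x = T} = ∅ := by
      ext x
      simp only [Set.mem_ofPred_eq, Set.mem_empty_iff_false, iff_false, not_and]
      rintro _ rfl
      exact hTK (hits_subset _ _ _)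
    rw [this]
    exact .empty

/-- Double counting: integrate over `B` the number of elements of `K` moving a point into `D`. -/
lemma mul_measureReal_le_sum (μ : Measure X) [IsFiniteMeasure μ] {K : Finset G} {D : Set X}
    (hD : MeasurableSet D) {B : Set X} (hB : MeasurableSet B) {c : ℝ}
    (hc : ∀ x ∈ B, c ≤ (hits K D x).card) :
    c * μ.real B ≤ ∑ g ∈ K, μ.real (B ∩ g⁻¹ • D) := by
  classical
  have hm : ∀ g : G, MeasurableSet (B ∩ g⁻¹ • D) := fun g => hB.inter (hD.const_smul _)
  have hi : ∀ g : G, Integrable ((B ∩ g⁻¹ • D).indicator (1 : X → ℝ)) μ := fun g =>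
    (integrable_const (1 : ℝ)).indicator (hm g)
  have h1 : ∑ g ∈ K, μ.real (B ∩ g⁻¹ • D) =
      ∫ x, ∑ g ∈ K, (B ∩ g⁻¹ • D).indicator (1 : X → ℝ) x ∂μ := by
    rw [integral_finsetSum _ fun g _ => hi g]
    exact Finset.sum_congr rfl fun g _ => (integral_indicator_one (hm g)).symm
  have h2 : c * μ.real B = ∫ x, B.indicator (fun _ => c) x ∂μ := by
    rw [integral_indicator_const _ hB, smul_eq_mul, mul_comm]
  rw [h1, h2]
  refine integral_mono ((integrable_const _).indicator hB)
    (integrable_finsetSum _ fun g _ => hi g) fun x => ?_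
  by_cases hx : x ∈ B
  · rw [Set.indicator_of_mem hx]
    refine (hc x hx).trans (le_of_eq ?_)
    rw [hits, Finset.card_filter]
    push_cast
    refine Finset.sum_congr rfl fun g _ => ?_
    simp [Set.indicator_apply, hx, Set.mem_inv_smul_set_iff]
  · rw [Set.indicator_of_notMem hx]
    exact Finset.sum_nonneg fun g _ => Set.indicator_nonneg (fun _ _ => zero_le_one) _

/-- The points of `A` that are moved out of `A` by some element of `F`. -/
def escaping (F : Finset G) (A : Set X) : Set X := {x | x ∈ A ∧ ∃ f ∈ F, f • x ∉ A}

lemma escaping_mono {F F' : Finset G} (h : F ⊆ F') (A : Set X) : escaping F A ⊆ escaping F' A :=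
  fun _ hx => ⟨hx.1, hx.2.imp fun _ hf => ⟨h hf.1, hf.2⟩⟩

open scoped Classical in
/-- The elements of `K` that are moved out of `K` by some element of `F`. -/
noncomputable def shapeEscaping (F K : Finset G) : Finset G := {g ∈ K | ∃ f ∈ F, f * g ∉ K}

/-- One step of the greedy algorithm: tiles with shape almost equal to `K` are placed at those
points of `P` whose `K`-orbit is not yet covered to a proportion `θ`. -/
lemma Tiled.exists_extension {K : Finset G} {θ : ℝ} (hθ1 : θ ≤ 1)
    (hQ : ∀ T ⊆ K, (((K.card - T.card : ℕ) : ℝ) ≤ θ * K.card) → Q T)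
    (hA : Tiled Q ε A) {P : Set X} (hP : NullFrontier G P)
    (hPdis : ∀ g ∈ K, ∀ h ∈ K, g ≠ h → Disjoint (g • P) (h • P))
    (hPd : ∀ g ∈ K, Metric.diam (g • P) < ε) :
    ∃ A' : Set X, Tiled Q ε A' ∧ A ⊆ A' ∧ (∀ x ∈ P, θ * K.card ≤ (hits K A' x).card) ∧
      ∀ (F : Finset G) (κ : ℝ), 0 ≤ κ → ((shapeEscaping F K).card : ℝ) ≤ κ * ((1 - θ) * K.card) →
        ∀ μ ∈ invariantMeasures G X,
          μ.real (escaping F A') ≤ μ.real (escaping F A) + κ * (μ.real A' - μ.real A) := by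
  classical
  -- `T` is the part of `K` already used at a point. Over the base `W T` the new tile is `K \ T`,
  -- which avoids `A` and keeps a proportion at least 1 - θ of `K`.
  let 𝒯 : Finset (Finset G) := {T ∈ K.powerset | (T.card : ℝ) ≤ θ * K.card}
  let W : Finset G → Set X := fun T => {x | x ∈ P ∧ hits K A x = T}
  have hW : ∀ T, NullFrontier G (W T) := fun T => hA.nullFrontier.setOf_hits_eq hP K T
  have hWP : ∀ T, W T ⊆ P := fun T x hx => hx.1
  have htiled : ∀ 𝒮 ⊆ 𝒯, Tiled Q ε (A ∪ ⋃ T ∈ 𝒮, ⋃ g ∈ K \ T, g • W T) := by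
    intro 𝒮
    induction 𝒮 using Finset.induction_on with
    | empty => simpa using hA
    | insert T 𝒮 hT𝒮 ih =>
      intro hsub
      obtain ⟨hT𝒯, hsub⟩ := Finset.insert_subset_iff.1 hsub
      obtain ⟨hTK, hTcard⟩ := Finset.mem_filter.1 hT𝒯
      rw [Finset.mem_powerset] at hTK
      rw [Finset.set_biUnion_insert, Set.union_comm (⋃ g ∈ K \ T, _), ← Set.union_assoc]
      refine (ih hsub).union (hW T) (hQ _ Finset.sdiff_subset ?_) (fun t ht => ?_) ?_ ?_
      · rw [Finset.card_sdiff_of_subset hTK, Nat.sub_sub_self (Finset.card_le_card hTK)]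
        exact hTcard
      · exact (Metric.diam_mono (Set.smul_set_mono (hWP T))
          Metric.isBounded_of_compactSpace).trans_lt (hPd t (Finset.mem_sdiff.1 ht).1)
      · intro s hs t ht hst
        exact (hPdis s (Finset.mem_sdiff.1 hs).1 t (Finset.mem_sdiff.1 ht).1 hst).mono
          (Set.smul_set_mono (hWP T)) (Set.smul_set_mono (hWP T))
      · intro t ht
        obtain ⟨htK, htT⟩ := Finset.mem_sdiff.1 ht
        rw [Set.disjoint_left]
        rintro _ ⟨x, hx, rfl⟩ hmem
        rcases hmem with hmem | hmem
        · exact htT (hx.2 ▸ mem_hits.2 ⟨htK, hmem⟩)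
        · simp only [Set.mem_iUnion, exists_prop] at hmem
          obtain ⟨T', hT', g, hg, y, hy, hyx⟩ := hmem
          obtain ⟨hgK, -⟩ := Finset.mem_sdiff.1 hg
          by_cases hgt : g = t
          · subst hgt
            have hxy : y = x := MulAction.injective g hyx
            subst hxy
            have : T' = T := hy.2.symm.trans hx.2
            exact hT𝒮 (this ▸ hT')
          · exact Set.disjoint_left.1 (hPdis g hgK t htK hgt)
              (Set.smul_mem_smul_set hy.1)
              ((show g • y = t • x from hyx) ▸ Set.smul_mem_smul_set hx.1)
  let B : Set X := {x | x ∈ P ∧ ((hits K A x).card : ℝ) ≤ θ * K.card}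
  have hBW : B = ⋃ T ∈ 𝒯, W T := by
    ext x
    simp only [B, W, 𝒯, Set.mem_iUnion, Set.mem_ofPred_eq, exists_prop, Finset.mem_filter,
      Finset.mem_powerset]
    constructor
    · rintro ⟨h1, h2⟩
      exact ⟨_, ⟨hits_subset _ _ _, h2⟩, h1, rfl⟩
    · rintro ⟨T, ⟨h1, h2⟩, h3, rfl⟩
      exact ⟨h3, h2⟩
  have hBm : MeasurableSet B := by
    rw [hBW]
    exact (NullFrontier.biUnion fun T _ => hW T).1
  have hA' : A ∪ ⋃ T ∈ 𝒯, ⋃ g ∈ K \ T, g • W T = A ∪ ⋃ g ∈ K, g • B := by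
    ext y
    simp only [Set.mem_union, Set.mem_iUnion, exists_prop, Finset.mem_sdiff]
    refine ⟨?_, ?_⟩
    · rintro (h | ⟨T, hT, g, ⟨hg, -⟩, x, hx, rfl⟩)
      · exact Or.inl h
      · refine Or.inr ⟨g, hg, Set.smul_mem_smul_set ?_⟩
        rw [hBW]
        exact Set.mem_biUnion hT hx
    · rintro (h | ⟨g, hg, x, hx, rfl⟩)
      · exact Or.inl h
      · by_cases hgx : g • x ∈ A
        · exact Or.inl hgx
        · refine Or.inr ⟨hits K A x, ?_, g, ⟨hg, fun h => hgx (mem_hits.1 h).2⟩,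
            Set.smul_mem_smul_set ⟨hx.1, rfl⟩⟩
          exact Finset.mem_filter.2 ⟨Finset.mem_powerset.2 (hits_subset _ _ _), hx.2⟩
  have hKB : ∀ g ∈ K, ∀ x ∈ B, g • x ∈ A ∪ ⋃ g ∈ K, g • B := fun g hg x hx =>
    Or.inr (Set.mem_biUnion (x := g) hg (Set.smul_mem_smul_set hx))
  refine ⟨A ∪ ⋃ g ∈ K, g • B, hA' ▸ htiled 𝒯 subset_rfl, Set.subset_union_left, fun x hx => ?_, ?_⟩
  · by_cases hxB : x ∈ B
    · have : hits K (A ∪ ⋃ g ∈ K, g • B) x = K :=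
        (hits_subset _ _ _).antisymm fun g hg => mem_hits.2 ⟨hg, hKB g hg x hxB⟩
      rw [this]
      exact mul_le_of_le_one_left (by positivity) hθ1
    · have h1 : θ * K.card < (hits K A x).card := by
        by_contra! h
        exact hxB ⟨hx, h⟩
      refine h1.le.trans ?_
      exact_mod_cast Finset.card_le_card (hits_mono K Set.subset_union_left x)
  · intro F κ hκ hesc μ hμ
    obtain ⟨_, _, _⟩ := id hμ
    -- Each point of `B` contributes at least (1 - θ)|K| new points, and these are distinct because
    -- the translates of `P` are disjoint.
    have hgain : (1 - θ) * K.card * μ.real B ≤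
        μ.real (A ∪ ⋃ g ∈ K, g • B) - μ.real A := by
      have h1 : (1 - θ) * K.card * μ.real B ≤ ∑ g ∈ K, μ.real (B ∩ g⁻¹ • Aᶜ) := by
        refine mul_measureReal_le_sum μ hA.nullFrontier.1.compl hBm fun x hx => ?_
        have h2 : hits K Aᶜ x = K \ hits K A x := by
          ext g
          simp only [mem_hits, Finset.mem_sdiff, Set.mem_compl_iff]
          tauto
        rw [h2, Finset.card_sdiff_of_subset (hits_subset _ _ _),
          Nat.cast_sub (Finset.card_le_card (hits_subset _ _ _))]
        linarith [hx.2]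
      have h2 : ∑ g ∈ K, μ.real (B ∩ g⁻¹ • Aᶜ) = μ.real (⋃ g ∈ K, g • (B ∩ g⁻¹ • Aᶜ)) := by
        rw [measureReal_biUnion_finset]
        · simp only [measureReal_def, measure_smul]
        · intro g hg h hh hgh
          exact (hPdis g hg h hh hgh).mono
            (Set.smul_set_mono (Set.inter_subset_left.trans fun x hx => hx.1))
            (Set.smul_set_mono (Set.inter_subset_left.trans fun x hx => hx.1))
        · exact fun g _ => (hBm.inter (hA.nullFrontier.1.compl.const_smul _)).const_smul _
      have h3 : A ∪ ⋃ g ∈ K, g • B = A ∪ ⋃ g ∈ K, g • (B ∩ g⁻¹ • Aᶜ) := by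
        ext y
        simp only [Set.mem_union, Set.mem_iUnion, exists_prop, Set.smul_set_inter,
          smul_inv_smul, Set.mem_inter_iff, Set.mem_compl_iff]
        by_cases hy : y ∈ A <;> simp [hy]
      have h4 : Disjoint A (⋃ g ∈ K, g • (B ∩ g⁻¹ • Aᶜ)) := by
        simp only [Set.disjoint_iUnion_right, Set.smul_set_inter, smul_inv_smul]
        exact fun g _ => disjoint_compl_right.mono_right Set.inter_subset_right
      have h5 : MeasurableSet (⋃ g ∈ K, g • (B ∩ g⁻¹ • Aᶜ)) :=
        K.measurableSet_biUnion fun g _ =>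
          (hBm.inter (hA.nullFrontier.1.compl.const_smul _)).const_smul _
      rw [h3, measureReal_union h4 h5 (measure_ne_top _ _) (measure_ne_top _ _), ← h2]
      linarith
    -- The whole set `K • B` lies in the new union, so a point `g • x` with `x ∈ B` can escape only
    -- if `g` is moved out of `K`. Measuring this against the gain makes the bound telescope over
    -- successive extensions.
    have hsub : escaping F (A ∪ ⋃ g ∈ K, g • B) ⊆
        escaping F A ∪ ⋃ g ∈ shapeEscaping F K, g • B := by
      rintro y ⟨hy, f, hf, hfy⟩
      rcases hy with hy | hy
      · exact Or.inl ⟨hy, f, hf, fun h => hfy (Or.inl h)⟩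
      · right
        simp only [Set.mem_iUnion, exists_prop] at hy ⊢
        obtain ⟨g, hg, x, hx, rfl⟩ := hy
        refine ⟨g, Finset.mem_filter.2 ⟨hg, f, hf, fun hfg => hfy ?_⟩, Set.smul_mem_smul_set hx⟩
        have := hKB _ hfg x hx
        rwa [mul_smul] at this
    calc μ.real (escaping F (A ∪ ⋃ g ∈ K, g • B))
        ≤ μ.real (escaping F A) + μ.real (⋃ g ∈ shapeEscaping F K, g • B) :=
          (measureReal_mono hsub).trans (measureReal_union_le _ _)
      _ ≤ μ.real (escaping F A) + ∑ g ∈ shapeEscaping F K, μ.real (g • B) := by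
          gcongr
          exact measureReal_biUnion_finset_le _ _
      _ = μ.real (escaping F A) + (shapeEscaping F K).card * μ.real B := by
          simp [measureReal_def]
      _ ≤ μ.real (escaping F A) + κ * ((1 - θ) * K.card) * μ.real B := by gcongr
      _ ≤ _ := by
          rw [mul_assoc]
          gcongr

lemma Tiled.exists_extension_of_finset {K : Finset G} {θ : ℝ} (hθ1 : θ ≤ 1)
    (hQ : ∀ T ⊆ K, (((K.card - T.card : ℕ) : ℝ) ≤ θ * K.card) → Q T)
    (hA : Tiled Q ε A) {ι : Type*} (t : Finset ι) {P : ι → Set X}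
    (hP : ∀ i, NullFrontier G (P i) ∧
      (∀ g ∈ K, ∀ h ∈ K, g ≠ h → Disjoint (g • P i) (h • P i)) ∧
      ∀ g ∈ K, Metric.diam (g • P i) < ε) :
    ∃ A' : Set X, Tiled Q ε A' ∧ A ⊆ A' ∧
      (∀ i ∈ t, ∀ x ∈ P i, θ * K.card ≤ (hits K A' x).card) ∧
      ∀ (F : Finset G) (κ : ℝ), 0 ≤ κ → ((shapeEscaping F K).card : ℝ) ≤ κ * ((1 - θ) * K.card) →
        ∀ μ ∈ invariantMeasures G X,
          μ.real (escaping F A') ≤ μ.real (escaping F A) + κ * (μ.real A' - μ.real A) := by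
  classical
  induction t using Finset.induction_on with
  | empty => exact ⟨A, hA, subset_rfl, by simp, fun F κ _ _ μ _ => by simp⟩
  | insert i t _ ih =>
    obtain ⟨A₁, hA₁, hsub₁, hhit₁, hesc₁⟩ := ih
    obtain ⟨A₂, hA₂, hsub₂, hhit₂, hesc₂⟩ :=
      hA₁.exists_extension hθ1 hQ (hP i).1 (hP i).2.1 (hP i).2.2
    refine ⟨A₂, hA₂, hsub₁.trans hsub₂, fun j hj x hx => ?_, fun F κ hκ hF μ hμ => ?_⟩
    · rcases Finset.mem_insert.1 hj with rfl | hj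
      · exact hhit₂ x hx
      · refine (hhit₁ j hj x hx).trans ?_
        exact_mod_cast Finset.card_le_card (hits_mono K hsub₂ x)
    · have h1 := hesc₁ F κ hκ hF μ hμ
      have h2 := hesc₂ F κ hκ hF μ hμ
      linarith

/-- Points of `A` that `K` keeps in `A` have all their `K`-translates in `A'`; every other point has
a proportion `θ`. Integrating gives 1 - μ(A') ≤ (1 - θ)(1 - μ(D)), where `D` is the set of the
former points. -/
lemma one_sub_measureReal_le {K : Finset G} (hK : K.Nonempty) {θ : ℝ} (hθ1 : θ ≤ 1)
    {A A' : Set X} (hA : MeasurableSet A) (hA' : MeasurableSet A') (hAA' : A ⊆ A')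
    (hhit : ∀ x, θ * K.card ≤ (hits K A' x).card) {μ : Measure X}
    (hμ : μ ∈ invariantMeasures G X) :
    1 - μ.real A' ≤ (1 - θ) * (1 - μ.real A + μ.real (escaping K A)) := by
  classical
  obtain ⟨_, _, _⟩ := id hμ
  let D : Set X := A ∩ ⋂ g ∈ K, g⁻¹ • A
  have hD : MeasurableSet D :=
    hA.inter (Finset.measurableSet_biInter _ fun g _ => hA.const_smul _)
  have h1 : (K.card : ℝ) * μ.real D ≤ ∑ g ∈ K, μ.real (D ∩ g⁻¹ • A') := by
    refine mul_measureReal_le_sum μ hA' hD fun x hx => ?_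
    have : hits K A' x = K := (hits_subset _ _ _).antisymm fun g hg => mem_hits.2 ⟨hg, hAA' (by
      have := hx.2
      simp only [Set.mem_iInter, Set.mem_inv_smul_set_iff] at this
      exact this g hg)⟩
    rw [this]
  have h2 := mul_measureReal_le_sum μ hA' hD.compl (K := K) (c := θ * K.card) fun x _ => hhit x
  have h3 : ∑ g ∈ K, μ.real (D ∩ g⁻¹ • A') + ∑ g ∈ K, μ.real (Dᶜ ∩ g⁻¹ • A') =
      K.card * μ.real A' := by
    rw [← Finset.sum_add_distrib, ← nsmul_eq_mul, ← Finset.sum_const]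
    refine Finset.sum_congr rfl fun g _ => ?_
    have h4 := measureReal_inter_add_sdiff (μ := μ) (s := g⁻¹ • A') hD
    rw [Set.inter_comm D, Set.inter_comm Dᶜ, ← Set.sdiff_eq, h4]
    simp [measureReal_def]
  rw [probReal_compl_eq_one_sub hD] at h2
  have hKpos : (0 : ℝ) < K.card := by exact_mod_cast hK.card_pos
  have h5 : μ.real D + θ * (1 - μ.real D) ≤ μ.real A' := by
    refine le_of_mul_le_mul_left ?_ hKpos
    linarith
  have h6 : μ.real A ≤ μ.real D + μ.real (escaping K A) := by
    refine (measureReal_mono fun x hx => ?_).trans (measureReal_union_le _ _)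
    by_cases hxD : x ∈ D
    · exact Or.inl hxD
    · refine Or.inr ⟨hx, ?_⟩
      by_contra! h
      exact hxD ⟨hx, by simpa [Set.mem_inv_smul_set_iff] using h⟩
  nlinarith

/-- Iterating the greedy algorithm covers a set of measure almost one. -/
theorem HasGoodSubgroups.exists_tiled (hgood : HasGoodSubgroups G X) (hfree : IsFree G X)
    {Q : Finset G → Prop} {ε θ : ℝ} (hε : 0 < ε) (hθ0 : 0 < θ) (hθ : θ ≤ 1 / 2)
    (hQ : ∀ (F : Finset G) (κ : ℝ), 0 < κ → ∃ K : Finset G, K.Nonempty ∧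
      ((shapeEscaping F K).card : ℝ) ≤ κ * K.card ∧
      ∀ T ⊆ K, (((K.card - T.card : ℕ) : ℝ) ≤ θ * K.card) → Q T)
    (n : ℕ) (F : Finset G) {η : ℝ} (hη : 0 < η) :
    ∃ A : Set X, Tiled Q ε A ∧ ∀ μ ∈ invariantMeasures G X,
      1 - μ.real A ≤ (1 - θ) ^ n + η ∧ μ.real (escaping F A) ≤ η := by
  classical
  induction n generalizing F η with
  | zero =>
    refine ⟨∅, .empty, fun μ hμ => ?_⟩
    have : escaping F (∅ : Set X) = ∅ := by
      ext x
      simp [escaping]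
    rw [this]
    constructor <;> simp [hη.le]
  | succ n ih =>
    obtain ⟨K, hK, hKesc, hKQ⟩ := hQ F (η / 4) (by positivity)
    -- The shape of the last round is chosen first, so that the earlier tiling can be made almost
    -- invariant under it. This is why the induction generalizes `F` and `η`.
    obtain ⟨A, hA, hAμ⟩ := ih (F ∪ K) (η := η / 2) (by positivity)
    obtain ⟨t, P, hcov, hP⟩ := hgood.exists_adapted_cover hfree K hε
    obtain ⟨A', hA', hsub, hhit, hesc⟩ :=
      hA.exists_extension_of_finset (by linarith) hKQ t hP
    refine ⟨A', hA', fun μ hμ => ?_⟩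
    have := hμ.1
    obtain ⟨h1, h2⟩ := hAμ μ hμ
    have h3 : μ.real (escaping F A) ≤ η / 2 :=
      (measureReal_mono (escaping_mono Finset.subset_union_left A)).trans h2
    have h4 : μ.real (escaping K A) ≤ η / 2 :=
      (measureReal_mono (escaping_mono Finset.subset_union_right A)).trans h2
    have h5 := one_sub_measureReal_le hK (show θ ≤ 1 by linarith) hA.nullFrontier.1 hA'.nullFrontier.1 hsub
      (fun x => by
        obtain ⟨i, hi, hx⟩ := hcov x
        exact hhit i hi x hx) hμ
    -- Since θ ≤ 1/2, η/4 ≤ (η/2)(1 - θ).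
    have h6 := hesc F (η / 2) (by positivity) (by
      refine hKesc.trans ?_
      have : (0 : ℝ) ≤ η * K.card := by positivity
      nlinarith) μ hμ
    have h7 : μ.real A' - μ.real A ≤ 1 := by
      linarith [measureReal_le_one (μ := μ) (s := A'), measureReal_nonneg (μ := μ) (s := A)]
    constructor
    · calc 1 - μ.real A' ≤ (1 - θ) * (1 - μ.real A + μ.real (escaping K A)) := h5
        _ ≤ (1 - θ) * ((1 - θ) ^ n + η) := by
            refine mul_le_mul_of_nonneg_left ?_ (by linarith)
            linarith
        _ ≤ _ := by
            rw [pow_succ]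
            nlinarith
    · nlinarith

end Tilings

/-! ### Følner shapes and their large subsets. -/

section Shapes

variable {Γ : Type*} [Group Γ]

lemma isInvariantShape_iff [DecidableEq Γ] {F S : Finset Γ} {ε : ℝ} :
    IsInvariantShape F ε S ↔ ((S ∆ (F * S)).card : ℝ) < ε * S.card := by
  rw [IsInvariantShape, ← Finset.coe_mul, ← Finset.coe_symmDiff, Set.ncard_coe_finset]

lemma IsInvariantShape.mono {F S : Finset Γ} {ε ε' : ℝ} (h : IsInvariantShape F ε S)
    (hε : ε ≤ ε') : IsInvariantShape F ε' S :=
  lt_of_lt_of_le h (by gcongr)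

lemma card_symmDiff_mul_le [DecidableEq Γ] {F : Finset Γ} (hF : F.Nonempty) (K : Finset Γ) :
    (K ∆ (F * K)).card ≤ ∑ f ∈ F, ((f • K) ∆ K).card := by
  refine (Finset.card_le_card fun x hx => ?_).trans Finset.card_biUnion_le
  rw [Finset.mem_biUnion]
  rcases Finset.mem_symmDiff.1 hx with ⟨hxK, hxFK⟩ | ⟨hxFK, hxK⟩
  · obtain ⟨f, hf⟩ := hF
    exact ⟨f, hf, Finset.mem_symmDiff.2 (Or.inr ⟨hxK, fun h => hxFK
      (Finset.smul_finset_subset_mul hf h)⟩)⟩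
  · obtain ⟨f, hf, k, hk, rfl⟩ := Finset.mem_mul.1 hxFK
    exact ⟨f, hf, Finset.mem_symmDiff.2 (Or.inl ⟨Finset.smul_mem_smul_finset hk, hxK⟩)⟩

lemma card_shapeEscaping_le [DecidableEq Γ] (F K : Finset Γ) :
    (shapeEscaping F K).card ≤ ∑ f ∈ F, ((f • K) ∆ K).card := by
  have h1 : shapeEscaping F K ⊆ F.biUnion fun f => {g ∈ K | f * g ∉ K} := by
    intro g hg
    simp only [shapeEscaping, Finset.mem_filter] at hg
    obtain ⟨hgK, f, hf, hfg⟩ := hg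
    exact Finset.mem_biUnion.2 ⟨f, hf, Finset.mem_filter.2 ⟨hgK, hfg⟩⟩
  refine (Finset.card_le_card h1).trans (Finset.card_biUnion_le.trans
    (Finset.sum_le_sum fun f _ => ?_))
  refine Finset.card_le_card_of_injOn (fun g => f * g) (fun g hg => ?_)
    (mul_right_injective f).injOn
  obtain ⟨hgK, hfg⟩ := Finset.mem_filter.1 hg
  exact Finset.mem_symmDiff.2 (Or.inl ⟨Finset.smul_mem_smul_finset hgK, hfg⟩)

/-- Subsets of almost full proportion of an invariant shape are invariant. -/
lemma isInvariantShape_of_subset {F K T : Finset Γ} (hK : K.Nonempty) {ε θ : ℝ} (hε : 0 < ε)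
    (hθ : θ ≤ 1 / 2) (hθF : (1 + F.card) * θ ≤ ε / 8) (hFK : IsInvariantShape F (ε / 4) K)
    (hTK : T ⊆ K) (hT : ((K.card - T.card : ℕ) : ℝ) ≤ θ * K.card) :
    IsInvariantShape F ε T ∧ (K.card : ℝ) ≤ 2 * T.card := by
  classical
  have hKpos : (0 : ℝ) < K.card := by exact_mod_cast hK.card_pos
  have hTcard : (K.card : ℝ) ≤ 2 * T.card := by
    rw [Nat.cast_sub (Finset.card_le_card hTK)] at hT
    nlinarith
  refine ⟨?_, hTcard⟩
  rw [isInvariantShape_iff] at *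
  have h1 : T ∆ (F * T) ⊆ (K ∆ (F * K)) ∪ ((K \ T) ∪ F * (K \ T)) := by
    intro x hx
    simp only [Finset.mem_union, Finset.mem_symmDiff, Finset.mem_sdiff] at hx ⊢
    rcases hx with ⟨hxT, hxFT⟩ | ⟨hxFT, hxT⟩
    · by_cases hxFK : x ∈ F * K
      · obtain ⟨f, hf, k, hk, rfl⟩ := Finset.mem_mul.1 hxFK
        refine Or.inr (Or.inr (Finset.mul_mem_mul hf (Finset.mem_sdiff.2 ⟨hk, fun hkT => ?_⟩)))
        exact hxFT (Finset.mul_mem_mul hf hkT)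
      · exact Or.inl (Or.inl ⟨hTK hxT, hxFK⟩)
    · by_cases hxK : x ∈ K
      · exact Or.inr (Or.inl ⟨hxK, hxT⟩)
      · exact Or.inl (Or.inr ⟨Finset.mul_subset_mul_left hTK hxFT, hxK⟩)
  have h2 : (T ∆ (F * T)).card ≤
      (K ∆ (F * K)).card + ((K.card - T.card) + F.card * (K.card - T.card)) := by
    refine (Finset.card_le_card h1).trans ((Finset.card_union_le _ _).trans ?_)
    gcongr
    refine (Finset.card_union_le _ _).trans ?_
    rw [← Finset.card_sdiff_of_subset hTK]
    gcongr
    exact Finset.card_mul_le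
  have h3 : ((T ∆ (F * T)).card : ℝ) ≤ (K ∆ (F * K)).card +
      (1 + F.card) * (K.card - T.card : ℕ) := by
    have : ((T ∆ (F * T)).card : ℝ) ≤ (K ∆ (F * K)).card +
      (((K.card - T.card : ℕ) : ℝ) + F.card * (K.card - T.card : ℕ)) := by exact_mod_cast h2
    linarith
  have h4 : (1 + (F.card : ℝ)) * (K.card - T.card : ℕ) ≤ ε / 8 * K.card := by
    calc (1 + (F.card : ℝ)) * (K.card - T.card : ℕ) ≤ (1 + F.card) * (θ * K.card) := by gcongr
      _ = (1 + F.card) * θ * K.card := by ring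
      _ ≤ _ := by gcongr
  -- The total is below (ε/4 + ε/8)|K| ≤ (3ε/4)|T|.
  nlinarith

lemma IsAmenable.exists_shape (hΓ : IsAmenable Γ) [Infinite Γ] {F₀ : Finset Γ} (hF₀ : F₀.Nonempty)
    {ε : ℝ} (hε : 0 < ε) (N : ℕ) (F : Finset Γ) {κ : ℝ} (hκ : 0 < κ) :
    ∃ K : Finset Γ, K.Nonempty ∧ ((shapeEscaping F K).card : ℝ) ≤ κ * K.card ∧
      IsInvariantShape F₀ ε K ∧ N ≤ K.card := by
  classical
  obtain ⟨F₁, hF₁⟩ := Infinite.exists_subset_card_eq Γ N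
  set E := F ∪ F₀ ∪ F₁ with hE
  obtain ⟨δ, hδ, hδκ, hδ1, hδε⟩ : ∃ δ : ℝ, 0 < δ ∧ δ ≤ κ ∧ δ ≤ 1 / 2 ∧ δ ≤ ε / 2 :=
    ⟨min (min κ (1 / 2)) (ε / 2), by positivity, (min_le_left _ _).trans (min_le_left _ _),
      (min_le_left _ _).trans (min_le_right _ _), min_le_right _ _⟩
  obtain ⟨K, hK, hKE⟩ := hΓ E (δ / (E.card + 1)) (by positivity)
  have hKpos : (0 : ℝ) < K.card := by exact_mod_cast hK.card_pos
  have hsum : ∀ E' ⊆ E, ((∑ f ∈ E', ((f • K) ∆ K).card : ℕ) : ℝ) ≤ δ * K.card := by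
    intro E' hE'
    have h1 : ∀ f ∈ E', (((f • K) ∆ K).card : ℝ) ≤ δ / (E.card + 1) * K.card := fun f hf => by
      have := hKE f (hE' hf)
      rw [← Finset.coe_smul_finset, ← Finset.coe_symmDiff, Set.ncard_coe_finset] at this
      exact this.le
    push_cast
    refine (Finset.sum_le_card_nsmul _ _ _ h1).trans ?_
    have h2 : (E'.card : ℝ) ≤ E.card + 1 := by
      have : (E'.card : ℝ) ≤ E.card := by exact_mod_cast Finset.card_le_card hE'
      linarith
    rw [nsmul_eq_mul]
    calc (E'.card : ℝ) * (δ / (E.card + 1) * K.card)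
        ≤ (E.card + 1) * (δ / (E.card + 1) * K.card) := by gcongr
      _ = δ * K.card := by field_simp
  have hesc : ∀ E' ⊆ E, ((shapeEscaping E' K).card : ℝ) ≤ δ * K.card := fun E' hE' =>
    (Nat.cast_le.2 (card_shapeEscaping_le E' K)).trans (hsum E' hE')
  refine ⟨K, hK, (hesc F ?_).trans (by gcongr), ?_, ?_⟩
  · exact Finset.subset_union_left.trans Finset.subset_union_left
  · rw [isInvariantShape_iff]
    have h1 := (Nat.cast_le (α := ℝ).2 (card_symmDiff_mul_le hF₀ K)).trans
      (hsum F₀ (Finset.subset_union_right.trans Finset.subset_union_left))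
    nlinarith
  -- At most half of `K` escapes under `F₁`, so some `g ∈ K` has `F₁ g ⊆ K`, giving |K| ≥ |F₁| = N.
  · have h1 : shapeEscaping F₁ K ≠ K := fun h => by
      have := hesc F₁ Finset.subset_union_right
      rw [h] at this
      nlinarith
    obtain ⟨g, hg, hgesc⟩ : ∃ g ∈ K, g ∉ shapeEscaping F₁ K := by
      by_contra! hcon
      exact h1 (Finset.Subset.antisymm (Finset.filter_subset _ _) hcon)
    rw [← hF₁]
    refine Finset.card_le_card_of_injOn (fun f => f * g) (fun f hf => ?_)
      (mul_left_injective g).injOn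
    by_contra hfg
    exact hgesc (Finset.mem_filter.2 ⟨hg, f, hf, hfg⟩)

end Shapes

/-! ### Free actions: almost finiteness. -/

section AlmostFinite

variable {Γ X : Type*} [Group Γ] [MetricSpace X] [CompactSpace X] [MeasurableSpace X]
  [BorelSpace X] [MulAction Γ X] [ContinuousConstSMul Γ X]

lemma HasGoodSubgroups.infinite (hgood : HasGoodSubgroups Γ X) : Infinite Γ := by
  by_contra hfin
  rw [not_infinite_iff_finite] at hfin
  have := Fintype.ofFinite Γ
  obtain ⟨Λ₁, -, -, hN, -⟩ := hgood ∅ (Fintype.card Γ + 1)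
  obtain ⟨F, hF⟩ := exists_finset_card_eq hN
  have h1 := Finset.card_le_univ (F.map (Function.Embedding.subtype _))
  rw [Finset.card_map, hF] at h1
  omega

/-- A free action with good subgroups has open castles with invariant large shapes, small levels
and small remainder. -/
lemma HasGoodSubgroups.exists_open_castle (hgood : HasGoodSubgroups Γ X) (hΓ : IsAmenable Γ)
    (hfree : IsFree Γ X) {F : Finset Γ} (hF : F.Nonempty) {ε : ℝ} (hε : 0 < ε) (N : ℕ)
    {δ : ℝ} (hδ : 0 < δ) :
    ∃ (n : ℕ) (S : Fin n → Finset Γ) (V : Fin n → Set X), IsCastle S V ∧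
      (∀ i, IsInvariantShape F ε (S i)) ∧ (∀ i, N ≤ (S i).card) ∧
      (∀ i, ∀ s ∈ S i, Metric.diam (s • V i) < ε) ∧
      ∀ μ ∈ invariantMeasures Γ X, 1 - δ ≤ ∑ i, ((S i).card : ℝ) * μ.real (V i) := by
  have := hgood.infinite
  obtain ⟨θ, hθ0, hθ1, hθF⟩ : ∃ θ : ℝ, 0 < θ ∧ θ ≤ 1 / 2 ∧ (1 + F.card) * θ ≤ ε / 8 := by
    refine ⟨min (1 / 2) (ε / 8 / (1 + F.card)), by positivity, min_le_left _ _, ?_⟩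
    calc (1 + (F.card : ℝ)) * min (1 / 2) (ε / 8 / (1 + F.card))
        ≤ (1 + F.card) * (ε / 8 / (1 + F.card)) := by gcongr; exact min_le_right _ _
      _ = ε / 8 := by field_simp
  obtain ⟨k, hk⟩ := exists_pow_lt_of_lt_one (half_pos hδ) (show 1 - θ < 1 by linarith)
  obtain ⟨A, hA, hAμ⟩ := hgood.exists_tiled hfree
    (Q := fun T => IsInvariantShape F ε T ∧ N ≤ T.card) hε hθ0 hθ1 (fun F' κ hκ => by
      obtain ⟨K, hK, hKesc, hKF, hKN⟩ :=
        -- `2 * N`, because a tile may retain only half of the shape.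
        hΓ.exists_shape hF (show 0 < ε / 4 by positivity) (2 * N) F' hκ
      refine ⟨K, hK, hKesc, fun T hTK hT => ?_⟩
      obtain ⟨h1, h2⟩ := isInvariantShape_of_subset hK hε hθ1 hθF hKF hTK hT
      refine ⟨h1, ?_⟩
      have h3 : K.card ≤ 2 * T.card := by exact_mod_cast h2
      omega) k ∅ (half_pos hδ)
  obtain ⟨n, S, V, hV, hdis, hS, hd, rfl⟩ := hA.exists_castle
  have hc : IsCastle S fun i => interior (V i) :=
    ⟨fun i => isOpen_interior, fun i j s hs t ht hst => (hdis i j s hs t ht hst).mono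
      (Set.smul_set_mono interior_subset) (Set.smul_set_mono interior_subset)⟩
  refine ⟨n, S, fun i => interior (V i), hc, fun i => (hS i).1, fun i => (hS i).2,
    fun i s hs => (Metric.diam_mono (Set.smul_set_mono interior_subset)
      Metric.isBounded_of_compactSpace).trans_lt (hd i s hs), fun μ hμ => ?_⟩
  have h1 := (hAμ μ hμ).1
  obtain ⟨_, _, _⟩ := id hμ
  have h2 : μ.real (⋃ i, ⋃ s ∈ S i, s • V i) ≤ ∑ i, ((S i).card : ℝ) * μ.real (V i) := by
    refine (measureReal_iUnion_fintype_le _).trans (Finset.sum_le_sum fun i _ => ?_)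
    refine (measureReal_biUnion_finset_le _ _).trans (le_of_eq ?_)
    simp [measureReal_def]
  have h3 : ∀ i, μ.real (interior (V i)) = μ.real (V i) := fun i => (hV i).measureReal_interior hμ
  simp only [h3]
  linarith

/-- A free action with good subgroups is almost finite. -/
theorem HasGoodSubgroups.isAlmostFinite (hgood : HasGoodSubgroups Γ X) (hΓ : IsAmenable Γ)
    (hfree : IsFree Γ X) : IsAlmostFinite Γ X := by
  classical
  intro F hF ε₀ hε₀
  -- `ε ≤ 1` ensures that a tower has ⌊ε|S i|⌋ levels to select.
  obtain ⟨ε, hε, hεε₀, hε1⟩ : ∃ ε : ℝ, 0 < ε ∧ ε ≤ ε₀ ∧ ε ≤ 1 :=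
    ⟨min ε₀ 1, by positivity, min_le_left _ _, min_le_right _ _⟩
  obtain ⟨n, S, V, hc, hS, hN, hd, hμ⟩ := hgood.exists_open_castle hΓ hfree hF hε ⌈4 / ε⌉₊
    (δ := ε / 4) (by positivity)
  refine ⟨n, S, V, hc, fun i => (hS i).mono hεε₀, fun i s hs => (hd i s hs).trans_le hεε₀,
    fun C hC hCsub => ?_⟩
  have hfloor : ∀ i, ⌊ε * ((S i).card : ℝ)⌋₊ ≤ (S i).card := fun i =>
    Nat.floor_le_of_le (mul_le_of_le_one_left (by positivity) hε1)
  choose T hTS hT using fun i => Finset.exists_subset_card_eq (hfloor i)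
  -- As ε|S i| ≥ 4, rounding down loses at most a quarter.
  have hT4 : ∀ i, 3 / 4 * ε * (S i).card ≤ (T i).card := fun i => by
    have h1 : 4 / ε ≤ (S i).card := (Nat.le_ceil _).trans (by exact_mod_cast hN i)
    rw [div_le_iff₀ hε] at h1
    have h2 := Nat.lt_floor_add_one (ε * ((S i).card : ℝ))
    rw [hT]
    linarith
  have hopen : IsOpen (⋃ i, ⋃ s ∈ T i, s • V i) :=
    isOpen_iUnion fun i => isOpen_iUnion fun s => isOpen_iUnion fun _ => (hc.1 i).smul s
  -- The remainder has measure at most ε/4, the selected levels at least (3/4)ε(1 - ε/4) ≥ (9/16)ε.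
  obtain ⟨m, U, s, hU, hcov, hsub, hdis⟩ :=
    hgood.exists_disjoint_translates hΓ (hC ()) hopen (fun μ hμ' => by
      have hp := hμ'.1
      have h1 := hμ μ hμ'
      have h2 : μ.real (C ()) ≤ ε / 4 := by
        have h3 : MeasurableSet (⋃ i, ⋃ s ∈ S i, s • V i) :=
          (isOpen_iUnion fun i => isOpen_iUnion fun s => isOpen_iUnion fun _ =>
            (hc.1 i).smul s).measurableSet
        refine (measureReal_mono (hCsub ())).trans ?_
        rw [← Set.compl_eq_univ_sdiff, probReal_compl_eq_one_sub h3,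
          hc.measureReal_iUnion hμ' fun i => Finset.Subset.refl _]
        linarith
      rw [hc.measureReal_iUnion hμ' hTS]
      have h4 : 3 / 4 * ε * ∑ i, ((S i).card : ℝ) * μ.real (V i) ≤
          ∑ i, ((T i).card : ℝ) * μ.real (V i) := by
        rw [Finset.mul_sum]
        refine Finset.sum_le_sum fun i _ => ?_
        rw [← mul_assoc]
        exact mul_le_mul_of_nonneg_right (hT4 i) measureReal_nonneg
      nlinarith)
  let idx : ∀ i, T i → Fin ⌊ε₀ * ((S i).card : ℝ)⌋₊ := fun i t =>
    Fin.castLE ((hT i).le.trans (Nat.floor_mono (by gcongr))) ((T i).equivFin t)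
  have hidx : ∀ i, Function.Injective (idx i) := fun i =>
    (Fin.castLE_injective _).comp (T i).equivFin.injective
  let I := Fin m × (i : Fin n) × T i
  let e : I ≃ Fin (Fintype.card I) := Fintype.equivFin I
  -- Cut each piece according to the selected level `t • V i` that receives it, then pull back by
  -- `t⁻¹` into `V i`. Different `t` use different copies of `V i`, so overlaps there are harmless.
  let O : I → Set X := fun p => U p.1 ∩ (s p.1)⁻¹ • (p.2.2 : Γ) • V p.2.1
  let r : I → Γ := fun p => (p.2.2 : Γ)⁻¹ * s p.1
  have hrO : ∀ p, r p • O p ⊆ (p.2.2 : Γ)⁻¹ • s p.1 • U p.1 := fun p => by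
    simp only [r, O, mul_smul]
    exact Set.smul_set_mono (Set.smul_set_mono Set.inter_subset_left)
  have hpair : ∀ p q : I, p ≠ q →
      (⟨p.2.1, idx _ p.2.2⟩ : (i : Fin n) × Fin ⌊ε₀ * ((S i).card : ℝ)⌋₊) = ⟨q.2.1, idx _ q.2.2⟩ →
      Disjoint (r p • O p) (r q • O q) := by
    rintro ⟨j, i, t⟩ ⟨j', i', t'⟩ hpq hb
    obtain ⟨h1, h2⟩ := Sigma.mk.inj_iff.1 hb
    dsimp only at h1
    subst h1
    have h3 := hidx _ (eq_of_heq h2)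
    dsimp only at h3
    subst h3
    refine Disjoint.mono (hrO _) (hrO _) ?_
    rw [Set.disjoint_smul_set]
    exact hdis fun h => hpq (Prod.ext h rfl)
  refine ⟨Fintype.card I, fun k => O (e.symm k), fun k => r (e.symm k), fun _ => (),
    fun k => ⟨(e.symm k).2.1, idx _ (e.symm k).2.2⟩, fun k => ?_, ?_, fun k => ?_, ?_⟩
  · exact (hU _).inter (((hc.1 _).smul _).smul _)
  · rintro ⟨⟩ x hx
    obtain ⟨j, hj⟩ := Set.mem_iUnion.1 (hcov hx)
    have h1 := hsub j (Set.smul_mem_smul_set hj)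
    simp only [Set.mem_iUnion, exists_prop] at h1
    obtain ⟨i, t, ht, hxt⟩ := h1
    simp only [Set.mem_iUnion, exists_prop, true_and]
    refine ⟨e ⟨j, i, ⟨t, ht⟩⟩, ?_⟩
    rw [Equiv.symm_apply_apply]
    exact ⟨hj, by rwa [Set.mem_inv_smul_set_iff]⟩
  · simp only [r, O, mul_smul]
    rw [Set.smul_set_subset_iff_subset_inv_smul_set, Set.smul_set_subset_iff_subset_inv_smul_set,
      inv_inv]
    exact Set.inter_subset_right
  · exact fun k l hkl hb => hpair _ _ (fun h => hkl (e.symm.injective h)) hb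

end AlmostFinite

end TopDyn

theorem mainTheorem2 {Γ X : Type*} [Group Γ] [Countable Γ]
    [MetricSpace X] [CompactSpace X] [MeasurableSpace X] [BorelSpace X]
    [MulAction Γ X] [ContinuousConstSMul Γ X]
    (hΓ : TopDyn.IsAmenable Γ) (hgood : TopDyn.HasGoodSubgroups Γ X) :
    TopDyn.HasComparison Γ X ∧ (TopDyn.IsFree Γ X → TopDyn.IsAlmostFinite Γ X) :=
  ⟨hgood.hasComparison hΓ, hgood.isAlmostFinite hΓ⟩
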